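/- Let $\mathbb K$ be a field, $F=\mathbb K\langle x_1,\dots,x_n\rangle$ the free associative algebra with its standard grading, $I\subset F$ a graded two-sided ideal and $A=F/I$. Let $P=\mathbb K[x_{ij}\mid 1\le i\le n,\ j\ge 1]$ be the polynomial algebra with its standard grading, let $Q\subset P$ be the ideal generated by all products $x_{ij}x_{kj}$ ($1\le i,k\le n$, $j\ge1$), and let $R=P/Q$. Let $\iota:F\to R$ be the $\mathbb K$-linear map with $x_{i_1}\cdots x_{i_d}\mapsto x_{i_11}\cdots x_{i_dd}$, let $\sigma:R\to R$ be the algebra endomorphism with $x_{ij}\mapsto x_{i,j+1}$, let $J\subset R$ be the ideal generated by $\bigcup_{k\ge0}\sigma^k(\iota(I))$, and let $S=R/J$. Then $\sigma$ and $\iota$ induce maps $\sigma:S\to S$ and $\iota:A\to S$. For $B=A$ or $B=S$ and integers $\Delta_1,\dots,\Delta_s\ge0$, let $\bigoplus_j B[-\Delta_j]$ be the graded free module (a right module if $B=A$) whose canonical basis elements, denoted $\epsilon_j$ for $B=A$ and $\epsilon'_j$ for $B=S$, have degrees $\Delta_j$. Let $\iota:\bigoplus_jA[-\Delta_j]\to\bigoplus_jS[-\Delta_j]$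 be the $\mathbb K$-linear map with $\epsilon_jf\mapsto\epsilon'_j\,\sigma^{\Delta_j}(\iota(f))$ for $f\in A$; in particular, when all shifts are $0$, this is the coordinatewise map $\iota:A^r\to S^r$. For a graded right submodule $N\subset\bigoplus_jA[-\Delta_j]$, let $L(N)\subset\bigoplus_jS[-\Delta_j]$ be the $S$-submodule generated by $\iota(N)$. A minimal basis of a graded submodule is a set of homogeneous generators none of which lies in the submodule generated by the others, and $b_d$ of the submodule is the number of elements of degree $d$ in a minimal basis. Let $M\subset A^r$ be a finitely generated graded right submodule, where $A^r$ has all shifts $0$, and let $\{g_1,\dots,g_s\}$ be a minimal basis of $M$ with $\deg g_j=\Delta_j$. Let $$\varphi:\bigoplus_jA[-\Delta_j]\to A^r,\quad \epsilon_j\mapsto g_j,\qquad L(\varphi):\bigoplus_jS[-\Delta_j]\to S^r,\quad \epsilon'_j\mapsto\iota(g_j),$$ be the corresponding homomorphisms of right $A$-modules and of $S$-modules, and put $K=\mathrm{Ker}\,\varphi$, $K'=\mathrm{Ker}\,L(\varphi)$ and $$C=\langle \epsilon'_jx_{kl}\mid 1\le j\le s,\ 1\le k\le n,\ 1\le l\le\Delta_j\rangle\subset\bigoplus_jS[-\Delta_j].$$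 Then $K'=C+L(K)$. Moreover, $K$, $K'$ and $C$ have minimal bases; for every $d\ge0$ each minimal basis of any of them has only finitely many elements of degree $d$; and, for any choice of the minimal bases, $b_d(K)=b_d(K')-b_d(C)$ for all $d\ge0$. -/

import Mathlib

namespace Letterplace

section Algebras

variable (𝕜 : Type*) [Field 𝕜] (n : ℕ)

/-- The free associative algebra `F = 𝕜⟨x₁, …, xₙ⟩`. -/
abbrev F := FreeAlgebra 𝕜 (Fin n)

/-- The homogeneous component `F_d`: the linear span of the words of length `d`. -/
def pieceF (d : ℕ) : Submodule 𝕜 (F 𝕜 n) :=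
  Submodule.span 𝕜
    {f | ∃ w : List (Fin n), w.length = d ∧ f = (w.map (FreeAlgebra.ι 𝕜)).prod}

/-- The polynomial algebra `P` in the commuting variables `x_{ij}`, `1 ≤ i ≤ n`, `j ≥ 1`.
Both indices are counted from `0`: the pair `(i, j)` stands for `x_{i+1, j+1}`. -/
abbrev P := MvPolynomial (Fin n × ℕ) 𝕜

/-- The monomial ideal `Q` of `P` generated by all products `x_{ij} x_{kj}`. -/
noncomputable def Q : Ideal (P 𝕜 n) :=
  Ideal.span {p | ∃ (i k : Fin n) (j : ℕ),
    p = MvPolynomial.X (i, j) * MvPolynomial.X (k, j)}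

/-- The commutative algebra `R = P / Q`. -/
abbrev R := P 𝕜 n ⧸ Q 𝕜 n

/-- The monomial `x_{i₁ 1} x_{i₂ 2} ⋯ x_{i_d d}` attached to the word `x_{i₁} ⋯ x_{i_d}`. -/
noncomputable def wordMonomial (w : List (Fin n)) : P 𝕜 n :=
  (w.zipIdx.map (fun p => MvPolynomial.X p)).prod

/-- The linear map `ι : F → R` sending a word to its letterplace monomial. -/
noncomputable def iotaF : F 𝕜 n →ₗ[𝕜] R 𝕜 n :=
  (FreeAlgebra.basisFreeMonoid 𝕜 (Fin n)).constr 𝕜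
    (fun w => Ideal.Quotient.mkₐ 𝕜 (Q 𝕜 n) (wordMonomial 𝕜 n w.toList))

/-- The shift `x_{ij} ↦ x_{i, j+1}` on `P`. -/
noncomputable def shiftP : P 𝕜 n →ₐ[𝕜] P 𝕜 n :=
  MvPolynomial.rename (fun p => (p.1, p.2 + 1))

theorem Q_le_comap_shiftP : Q 𝕜 n ≤ (Q 𝕜 n).comap (shiftP 𝕜 n) := by
  refine Ideal.span_le.2 ?_
  rintro _ ⟨i, k, j, rfl⟩
  refine Ideal.subset_span ⟨i, k, j + 1, ?_⟩
  simp [shiftP]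

/-- The endomorphism `σ` of `R` given by `x_{ij} ↦ x_{i, j+1}`. -/
noncomputable def sigmaR : R 𝕜 n →ₐ[𝕜] R 𝕜 n :=
  Ideal.quotientMapₐ (Q 𝕜 n) (shiftP 𝕜 n) (Q_le_comap_shiftP 𝕜 n)

variable {𝕜 n}

/-- The ideal `I` is graded: `I = ∑_d I ∩ F_d`. -/
def IsGraded (I : Ideal (F 𝕜 n)) : Prop :=
  I.restrictScalars 𝕜 = ⨆ d : ℕ, I.restrictScalars 𝕜 ⊓ pieceF 𝕜 n d

/-- The letterplace analogue `J = L(I)`: the ideal of `R` generated by `⋃_k σ^k(ι(I))`. -/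
noncomputable def J (I : Ideal (F 𝕜 n)) : Ideal (R 𝕜 n) :=
  Ideal.span (⋃ k : ℕ, (fun f => (sigmaR 𝕜 n)^[k] (iotaF 𝕜 n f)) '' (I : Set (F 𝕜 n)))

theorem J_le_comap_sigmaR (I : Ideal (F 𝕜 n)) : J I ≤ (J I).comap (sigmaR 𝕜 n) := by
  refine Ideal.span_le.2 ?_
  intro y hy
  obtain ⟨k, f, hf, rfl⟩ := Set.mem_iUnion.1 hy
  refine Ideal.subset_span (Set.mem_iUnion.2 ⟨k + 1, f, hf, ?_⟩)
  exact Function.iterate_succ_apply' _ _ _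

theorem iotaF_mem_J (I : Ideal (F 𝕜 n)) {f : F 𝕜 n} (hf : f ∈ I) : iotaF 𝕜 n f ∈ J I :=
  Ideal.subset_span (Set.mem_iUnion.2 ⟨0, f, hf, rfl⟩)

/-- The noncommutative algebra `A = F / I`. -/
abbrev A (I : Ideal (F 𝕜 n)) := F 𝕜 n ⧸ I

/-- The commutative algebra `S = R / J`. -/
abbrev S (I : Ideal (F 𝕜 n)) := R 𝕜 n ⧸ J I

/-- The endomorphism of `S` induced by `σ`. -/
noncomputable def sigma (I : Ideal (F 𝕜 n)) : S I →ₐ[𝕜] S I :=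
  Ideal.quotientMapₐ (J I) (sigmaR 𝕜 n) (J_le_comap_sigmaR I)

/-- The class in `S` of the variable `x_{ij}` (indices counted from `0`). -/
noncomputable def x (I : Ideal (F 𝕜 n)) (i : Fin n) (j : ℕ) : S I :=
  Ideal.Quotient.mkₐ 𝕜 (J I) (Ideal.Quotient.mkₐ 𝕜 (Q 𝕜 n) (MvPolynomial.X (i, j)))

/-- The homogeneous component `S_d`, the image of the forms of degree `d` of `P`. -/
noncomputable def pieceS (I : Ideal (F 𝕜 n)) (d : ℕ) : Submodule 𝕜 (S I) :=
  ((MvPolynomial.homogeneousSubmodule (Fin n × ℕ) 𝕜 d).map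
    (Ideal.Quotient.mkₐ 𝕜 (Q 𝕜 n)).toLinearMap).map (Ideal.Quotient.mkₐ 𝕜 (J I)).toLinearMap

/-- The submodule `C` generated by the elements `ε'_j x_{kl}` with `1 ≤ l ≤ Δ_j`
(that is, `l < Δ_j` when places are counted from `0`). -/
noncomputable def C {s : ℕ} (I : Ideal (F 𝕜 n)) (Δ : Fin s → ℕ) : Submodule (S I) (Fin s → S I) :=
  Submodule.span (S I)
    {c | ∃ (j : Fin s) (k : Fin n) (l : ℕ), l < Δ j ∧ c = Pi.single j (x I k l)}

variable (I : Ideal (F 𝕜 n)) [I.IsTwoSided]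

/-- The linear map `A → S` induced by `ι : F → R`. -/
noncomputable def iota : A I →ₗ[𝕜] S I :=
  ((I.restrictScalars 𝕜).liftQ
      ((Ideal.Quotient.mkₐ 𝕜 (J I)).toLinearMap ∘ₗ iotaF 𝕜 n)
      (fun _ hf => Ideal.Quotient.eq_zero_iff_mem.2 (iotaF_mem_J I hf))) ∘ₗ
    (Submodule.Quotient.restrictScalarsEquiv 𝕜 I).symm.toLinearMap

/-- The homogeneous component `A_d`, the image of `F_d`. -/
def pieceA (d : ℕ) : Submodule 𝕜 (A I) :=
  (pieceF 𝕜 n d).map (Ideal.Quotient.mkₐ 𝕜 I).toLinearMap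

/-- The module letterplace embedding `⨁_j A[-δ_j] → ⨁_j S[-δ_j]`,
`e_j f ↦ e'_j σ^{δ_j}(ι(f))`. -/
noncomputable def moduleIota {m : ℕ} (δ : Fin m → ℕ) (h : Fin m → A I) : Fin m → S I :=
  fun j => (sigma I)^[δ j] (iota I (h j))

end Algebras

section GradedModules

/-- The component of degree `d` of the free module `⨁_j B[-δ_j]`, where `B` carries the
grading `𝓑`: the `j`-th coordinate lies in `B_{d - δ_j}`, and is zero if `d < δ_j`. -/
def piece {𝕜 B : Type*} [Field 𝕜] [AddCommGroup B] [Module 𝕜 B] (𝓑 : ℕ → Submodule 𝕜 B)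
    {m : ℕ} (δ : Fin m → ℕ) (d : ℕ) : Submodule 𝕜 (Fin m → B) :=
  Submodule.pi Set.univ (fun j => if δ j ≤ d then 𝓑 (d - δ j) else ⊥)

/-- `G` is a minimal homogeneous basis of the submodule `N` of the module `V` with
homogeneous components `𝓥 d`: a set of homogeneous generators of `N` none of which is in the
submodule generated by the others. -/
structure IsMinimalBasis {𝕜 T V : Type*} [Field 𝕜] [Ring T] [AddCommGroup V] [Module 𝕜 V]
    [Module T V] (𝓥 : ℕ → Submodule 𝕜 V) (N : Submodule T V) (G : Set V) : Prop where
  homogeneous : ∀ g ∈ G, ∃ d, g ∈ 𝓥 d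
  span_eq : Submodule.span T G = N
  minimal : ∀ g ∈ G, g ∉ Submodule.span T (G \ {g})

/-- The elements of degree `d` of a set `G`. -/
def inDegree {𝕜 V : Type*} [Field 𝕜] [AddCommGroup V] [Module 𝕜 V]
    (𝓥 : ℕ → Submodule 𝕜 V) (G : Set V) (d : ℕ) : Set V :=
  {g ∈ G | g ∈ 𝓥 d}

end GradedModules

section Morphisms

variable {𝕜 : Type*} [Field 𝕜] {n : ℕ} (I : Ideal (F 𝕜 n)) [I.IsTwoSided] {r s : ℕ}

/-- The homomorphism of right modules `φ : ⨁_j A[-Δ_j] → A^r`, `∑_j ε_j f_j ↦ ∑_j g_j f_j`.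
Right `A`-modules are modules over `Aᵐᵒᵖ`. -/
def phi (g : Fin s → Fin r → A I) : (Fin s → A I) →ₗ[(A I)ᵐᵒᵖ] (Fin r → A I) where
  toFun f := ∑ j, MulOpposite.op (f j) • g j
  map_add' f f' := by
    simp only [Pi.add_apply, MulOpposite.op_add, add_smul, Finset.sum_add_distrib]
  map_smul' a f := by
    simp only [Pi.smul_apply, Finset.smul_sum, RingHom.id_apply]
    refine Finset.sum_congr rfl fun j _ => ?_
    rw [smul_smul]
    rfl

/-- The homomorphism of `S`-modules `L(φ) : ⨁_j S[-Δ_j] → S^r`, `ε'_j ↦ ι(g_j)`. -/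
noncomputable def Lphi (g : Fin s → Fin r → A I) : (Fin s → S I) →ₗ[S I] (Fin r → S I) :=
  Fintype.linearCombination (S I) (fun j => moduleIota I (fun _ => 0) (g j))

/-- The letterplace analogue `L(N)` of a right submodule `N` of `⨁_j A[-δ_j]`: the
`S`-submodule generated by `ι(N)`. -/
noncomputable def analogue (δ : Fin s → ℕ) (N : Submodule (A I)ᵐᵒᵖ (Fin s → A I)) :
    Submodule (S I) (Fin s → S I) :=
  Submodule.span (S I) (moduleIota I δ '' (N : Set (Fin s → A I)))

end Morphisms

end Letterplace

/-! The proof rests on linear maps `factor`, one for each `Δ`, from `S` to `A ⊗ S`. A monomial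
touching a place below `Δ` goes to zero. Otherwise let `u` be the word spelled by the consecutive
places from `Δ` up to the first unused one; if the rest lies beyond that gap, the image is `u ⊗
rest`. Three facts carry the argument: the map is well defined on `S` (`exists_factor`); multiplying
it back together gives the identity modulo the variables in the first `Δ` places
(`sub_recombine_factor_mem`); and it turns multiplication by `σ^Δ(ι(a))`, for `a` of degree `t`,
into the action of `a` on the map for `Δ + t` (`factor_sigmaIota_mul`).

If `∑ ι(g_j) h_j = 0`, the map at place `0` gives `∑ g_j · factor_{Δ_j}(h_j) = 0` in `A ⊗ S`.
Expanding the right tensor factor in a basis of `S`, the coefficient vectors are syzygies of `g`.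
Hence `h` is congruent modulo `C` to an element of `L(K)`, which gives `K' = C + L(K)`.

For the Betti numbers, the union of a minimal basis `D` of `C` and the image of a minimal basis `B`
of `K` is a minimal basis of `K'` (`isMinimalBasis_union`). No `ι(k)` is redundant, because applying
a functional with value `1` at `1` to the right factor of `A ⊗ S` gives a retraction that kills `C`,
maps `ι(k)` to `k` and maps the span of `ι(B')`, for `B' ⊆ B`, into the span of `B'`. No element of
`D` is redundant, because `C ∩ L(K)` lies in `C · S₊` (`mem_decomposables_of_mem_span`): the
coordinates of homogeneous syzygies have positive degree, as `g` is minimal. Graded Nakayama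
finishes this case and shows that `b_d` does not depend on the minimal basis. -/

namespace Letterplace

/-! ### Minimal bases over a connected graded algebra: Nakayama and invariance of `b_d`. -/

section GradedMinimalBases

/-- A family of submodules `𝓥 d` spanning `V`, with projections `π d` onto them. -/
structure IsGradedSpace {𝕜 V : Type*} [Field 𝕜] [AddCommGroup V] [Module 𝕜 V]
    (𝓥 : ℕ → Submodule 𝕜 V) (π : ℕ → V →ₗ[𝕜] V) : Prop where
  proj_same : ∀ {d v}, v ∈ 𝓥 d → π d v = v
  proj_ne : ∀ {d e v}, v ∈ 𝓥 e → e ≠ d → π d v = 0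
  iSup_eq_top : ⨆ d, 𝓥 d = ⊤

/-- A graded action of a connected graded algebra `T` on the graded space `V`. -/
structure IsGradedAction {𝕜 T V : Type*} [Field 𝕜] [Ring T] [Algebra 𝕜 T] [AddCommGroup V]
    [Module 𝕜 V] [Module T V] (𝓣 : ℕ → Submodule 𝕜 T) (𝓥 : ℕ → Submodule 𝕜 V)
    (π : ℕ → V →ₗ[𝕜] V) : Prop extends IsGradedSpace 𝓥 π where
  connected : ∀ t ∈ 𝓣 0, ∃ c : 𝕜, t = algebraMap 𝕜 T c
  scalars_iSup : ⨆ d, 𝓣 d = ⊤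
  mul_mem : ∀ {i j t u}, t ∈ 𝓣 i → u ∈ 𝓣 j → t * u ∈ 𝓣 (i + j)
  smul_mem : ∀ {i j t v}, t ∈ 𝓣 i → v ∈ 𝓥 j → t • v ∈ 𝓥 (i + j)

namespace IsGradedSpace

variable {𝕜 V : Type*} [Field 𝕜] [AddCommGroup V] [Module 𝕜 V]
  {𝓥 : ℕ → Submodule 𝕜 V} {π : ℕ → V →ₗ[𝕜] V}

theorem eq_zero (H : IsGradedSpace 𝓥 π) {d e : ℕ} {v : V} (hd : v ∈ 𝓥 d) (he : v ∈ 𝓥 e)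
    (hne : e ≠ d) : v = 0 := by
  rw [← H.proj_same hd, H.proj_ne he hne]

theorem mem_span_proj (H : IsGradedSpace 𝓥 π) (v : V) :
    v ∈ Submodule.span 𝕜 (Set.range fun d => π d v) ∧ ∀ d, π d v ∈ 𝓥 d := by
  have hfin : ∃ s : Finset ℕ, v = ∑ d ∈ s, π d v ∧ ∀ d, π d v ∈ 𝓥 d := by
    have hv : v ∈ ⨆ d, 𝓥 d := H.iSup_eq_top ▸ Submodule.mem_top
    obtain ⟨f, hf, rfl⟩ := (Submodule.mem_iSup_iff_exists_finsupp _ _).1 hv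
    have hπ : ∀ d, π d (f.sum fun _ x => x) = f d := by
      intro d
      rw [Finsupp.sum, map_sum]
      rw [Finset.sum_eq_single d]
      · exact H.proj_same (hf d)
      · intro e _ hne
        exact H.proj_ne (hf e) hne
      · intro hd
        rw [Finsupp.notMem_support_iff.1 hd, map_zero]
    exact ⟨f.support, by simp only [hπ]; rfl, fun d => by rw [hπ]; exact hf d⟩
  obtain ⟨s, hs, h⟩ := hfin
  refine ⟨?_, h⟩
  have : ∑ d ∈ s, π d v ∈ Submodule.span 𝕜 (Set.range fun d => π d v) :=
    Submodule.sum_mem _ fun d _ => Submodule.subset_span ⟨d, rfl⟩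
  rwa [← hs] at this

end IsGradedSpace

/-- The subspace `N · T₊`, where `T₊` is spanned by the elements of positive degree. -/
def decomposables {𝕜 T V : Type*} [Field 𝕜] [Ring T] [Algebra 𝕜 T] [AddCommGroup V]
    [Module 𝕜 V] [Module T V] (𝓣 : ℕ → Submodule 𝕜 T) (N : Submodule T V) : Submodule 𝕜 V :=
  Submodule.span 𝕜 {w | ∃ (i : ℕ) (t : T) (v : V), 0 < i ∧ t ∈ 𝓣 i ∧ v ∈ N ∧ w = t • v}

section

variable {𝕜 T V : Type*} [Field 𝕜] [Ring T] [Algebra 𝕜 T] [AddCommGroup V]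
  [Module 𝕜 V] [Module T V] {𝓣 : ℕ → Submodule 𝕜 T} {𝓥 : ℕ → Submodule 𝕜 V}
  {π : ℕ → V →ₗ[𝕜] V}

theorem decomposables_mono {N N' : Submodule T V} (h : N ≤ N') :
    decomposables 𝓣 N ≤ decomposables 𝓣 N' := by
  refine Submodule.span_mono ?_
  rintro _ ⟨i, t, v, hi, ht, hv, rfl⟩
  exact ⟨i, t, v, hi, ht, h hv, rfl⟩

variable [IsScalarTower 𝕜 T V]

theorem span_le_restrictScalars_span (X : Set V) :
    Submodule.span 𝕜 X ≤ (Submodule.span T X).restrictScalars 𝕜 :=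
  Submodule.span_le.2 Submodule.subset_span

namespace IsGradedAction

theorem mem_span_homogeneous_smul (H : IsGradedAction 𝓣 𝓥 π) {X : Set V} {v : V}
    (hv : v ∈ Submodule.span T X) :
    v ∈ Submodule.span 𝕜 {w | ∃ (i : ℕ) (t : T) (x : V), t ∈ 𝓣 i ∧ x ∈ X ∧ w = t • x} := by
  induction hv using Submodule.span_induction with
  | mem x hx =>
    have h1 : (1 : T) ∈ ⨆ d, 𝓣 d := H.scalars_iSup ▸ Submodule.mem_top
    obtain ⟨f, hf, hf1⟩ := (Submodule.mem_iSup_iff_exists_finsupp _ _).1 h1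
    have : x = ∑ d ∈ f.support, f d • x := by
      rw [← Finset.sum_smul]
      change x = (f.sum fun _ y => y) • x
      rw [hf1, one_smul]
    rw [this]
    exact Submodule.sum_mem _ fun d _ => Submodule.subset_span ⟨d, f d, x, hf d, hx, rfl⟩
  | zero => exact zero_mem _
  | add x y _ _ hx hy => exact add_mem hx hy
  | smul t x hxs hx =>
    have ht : t ∈ ⨆ d, 𝓣 d := H.scalars_iSup ▸ Submodule.mem_top
    obtain ⟨f, hf, rfl⟩ := (Submodule.mem_iSup_iff_exists_finsupp _ _).1 ht
    rw [Finsupp.sum, Finset.sum_smul]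
    refine Submodule.sum_mem _ fun d _ => ?_
    clear hxs
    induction hx using Submodule.span_induction with
    | mem w hw =>
      obtain ⟨i, u, x, hu, hx, rfl⟩ := hw
      exact Submodule.subset_span ⟨d + i, f d * u, x, H.mul_mem (hf d) hu, hx,
        (mul_smul _ _ _).symm⟩
    | zero => rw [smul_zero]; exact zero_mem _
    | add x y _ _ hx hy => rw [smul_add]; exact add_mem hx hy
    | smul c x _ hx =>
      -- Scalars of `𝕜` move past `T` because their images are central in `T`.
      rw [← algebraMap_smul T c x, ← mul_smul, ← Algebra.commutes, mul_smul, algebraMap_smul]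
      exact Submodule.smul_mem _ _ hx

theorem proj_mem_span_homogeneous_smul (H : IsGradedAction 𝓣 𝓥 π) {X : Set V}
    (hX : ∀ x ∈ X, ∃ e, x ∈ 𝓥 e) {v : V} (hv : v ∈ Submodule.span T X) (d : ℕ) :
    π d v ∈ Submodule.span 𝕜 {w | ∃ (i e : ℕ) (t : T) (x : V), t ∈ 𝓣 i ∧ x ∈ X ∧ x ∈ 𝓥 e ∧
      i + e = d ∧ w = t • x} := by
  have := H.mem_span_homogeneous_smul hv
  clear hv
  induction this using Submodule.span_induction with
  | mem w hw =>
    obtain ⟨i, t, x, ht, hx, rfl⟩ := hw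
    obtain ⟨e, he⟩ := hX x hx
    by_cases hd : i + e = d
    · rw [H.proj_same (hd ▸ H.smul_mem ht he)]
      exact Submodule.subset_span ⟨i, e, t, x, ht, hx, he, hd, rfl⟩
    · rw [H.proj_ne (H.smul_mem ht he) hd]
      exact zero_mem _
  | zero => rw [map_zero]; exact zero_mem _
  | add x y _ _ hx hy => rw [map_add]; exact add_mem hx hy
  | smul c x _ hx => rw [map_smul]; exact Submodule.smul_mem _ _ hx

theorem proj_mem_span (H : IsGradedAction 𝓣 𝓥 π) {X : Set V}
    (hX : ∀ x ∈ X, ∃ e, x ∈ 𝓥 e) {v : V} (hv : v ∈ Submodule.span T X) (d : ℕ) :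
    π d v ∈ Submodule.span T X := by
  refine (Submodule.span_le (p := (Submodule.span T X).restrictScalars 𝕜)).2 ?_
    (H.proj_mem_span_homogeneous_smul hX hv d)
  rintro _ ⟨i, e, t, x, -, hx, -, -, rfl⟩
  exact Submodule.smul_mem _ t (Submodule.subset_span hx)

/-- A positive-degree factor pushes degrees up strictly, so a generator contributing to degree `d`
must itself have degree below `d`. -/
theorem proj_decomposables_mem (H : IsGradedAction 𝓣 𝓥 π) {X : Set V}
    (hX : ∀ x ∈ X, ∃ e, x ∈ 𝓥 e) {y : V} (hy : y ∈ decomposables 𝓣 (Submodule.span T X))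
    (d : ℕ) : π d y ∈ Submodule.span T {x ∈ X | ∃ e < d, x ∈ 𝓥 e} := by
  induction hy using Submodule.span_induction with
  | mem w hw =>
    obtain ⟨i, t, v, hi, ht, hv, rfl⟩ := hw
    have := H.mem_span_homogeneous_smul hv
    clear hv
    induction this using Submodule.span_induction with
    | mem w hw =>
      obtain ⟨j, u, x, hu, hx, rfl⟩ := hw
      obtain ⟨e, he⟩ := hX x hx
      rw [← mul_smul]
      have hm := H.smul_mem (H.mul_mem ht hu) he
      by_cases hd : i + j + e = d
      · rw [H.proj_same (hd ▸ hm)]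
        exact Submodule.smul_mem _ _ (Submodule.subset_span ⟨hx, e, by omega, he⟩)
      · rw [H.proj_ne hm hd]
        exact zero_mem _
    | zero => rw [smul_zero, map_zero]; exact zero_mem _
    | add x y _ _ hx hy => rw [smul_add, map_add]; exact add_mem hx hy
    | smul c x _ hx =>
      rw [← algebraMap_smul T c x, ← mul_smul, ← Algebra.commutes, mul_smul, algebraMap_smul,
        map_smul]
      exact Submodule.smul_of_tower_mem _ _ hx
  | zero => rw [map_zero]; exact zero_mem _
  | add x y _ _ hx hy => rw [map_add]; exact add_mem hx hy
  | smul c x _ hx => rw [map_smul]; exact Submodule.smul_of_tower_mem _ _ hx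

/-- In degree `d` a term `t • x` either has `t` of degree zero, hence a scalar by connectedness, or
is decomposable. -/
theorem mem_span_inDegree_sup (H : IsGradedAction 𝓣 𝓥 π) {X : Set V}
    (hX : ∀ x ∈ X, ∃ e, x ∈ 𝓥 e) {v : V} (hv : v ∈ Submodule.span T X) {d : ℕ}
    (hd : v ∈ 𝓥 d) :
    v ∈ Submodule.span 𝕜 (inDegree 𝓥 X d) ⊔ decomposables 𝓣 (Submodule.span T X) := by
  rw [← H.proj_same hd]
  refine Submodule.span_le.2 ?_ (H.proj_mem_span_homogeneous_smul hX hv d)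
  rintro _ ⟨i, e, t, x, ht, hx, he, hie, rfl⟩
  rcases Nat.eq_zero_or_pos i with rfl | hi
  · obtain ⟨c, rfl⟩ := H.connected t ht
    rw [algebraMap_smul]
    rw [zero_add] at hie
    exact Submodule.smul_mem _ _ (Submodule.mem_sup_left
      (Submodule.subset_span ⟨hx, hie ▸ he⟩))
  · exact Submodule.mem_sup_right
      (Submodule.subset_span ⟨i, t, x, hi, ht, Submodule.subset_span hx, rfl⟩)

/-- Graded Nakayama: an element of a minimal basis is not generated by the others modulo the
decomposable elements. -/
theorem minimal_mod_decomposables (H : IsGradedAction 𝓣 𝓥 π) {N : Submodule T V} {G : Set V}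
    (hG : IsMinimalBasis 𝓥 N G) {g : V} (hg : g ∈ G) {z y : V}
    (hz : z ∈ Submodule.span T (G \ {g})) (hy : y ∈ decomposables 𝓣 N) : g ≠ z + y := by
  intro h
  obtain ⟨d, hd⟩ := hG.homogeneous g hg
  have hg0 : g ≠ 0 := fun h0 => hG.minimal g hg (h0 ▸ zero_mem _)
  refine hG.minimal g hg ?_
  rw [← hG.span_eq] at hy
  have h1 := H.proj_mem_span (fun x hx => hG.homogeneous x hx.1) hz d
  have h2 := H.proj_decomposables_mem hG.homogeneous hy d
  have h3 : π d g = π d z + π d y := by rw [← map_add, ← h]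
  rw [H.proj_same hd] at h3
  have h4 := add_mem h1 (Submodule.span_mono (t := G \ {g}) ?_ h2)
  · rwa [← h3] at h4
  · rintro x ⟨hx, e, he, hxe⟩
    refine ⟨hx, ?_⟩
    rintro rfl
    -- A nonzero `g` of degree `d` is not among the generators of smaller degree.
    exact hg0 (H.eq_zero hd hxe he.ne)

theorem linearIndependent_inDegree (H : IsGradedAction 𝓣 𝓥 π) {N : Submodule T V} {G : Set V}
    (hG : IsMinimalBasis 𝓥 N G) (d : ℕ) :
    LinearIndependent 𝕜 fun g : inDegree 𝓥 G d => (decomposables 𝓣 N).mkQ g := by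
  rw [linearIndependent_iff_notMem_span]
  rintro ⟨g, hg, hgd⟩ hmem
  rw [show (fun g : inDegree 𝓥 G d => (decomposables 𝓣 N).mkQ g) =
    (decomposables 𝓣 N).mkQ ∘ Subtype.val from rfl, Set.image_comp, Submodule.span_image] at hmem
  obtain ⟨z, hz, hzg⟩ := hmem
  have hy : g - z ∈ decomposables 𝓣 N := by
    rw [← Submodule.ker_mkQ (decomposables 𝓣 N), LinearMap.mem_ker, map_sub, hzg]
    exact sub_self _
  refine H.minimal_mod_decomposables hG hg (z := z) ?_ hy (by abel)
  refine span_le_restrictScalars_span _ (Submodule.span_mono ?_ hz)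
  rintro _ ⟨⟨x, hx⟩, hne, rfl⟩
  exact ⟨hx.1, fun h => hne.2 (Subtype.ext h)⟩

theorem span_inDegree (H : IsGradedAction 𝓣 𝓥 π) {N : Submodule T V} {G : Set V}
    (hG : ∀ x ∈ G, ∃ e, x ∈ 𝓥 e) (hN : Submodule.span T G = N) (d : ℕ) :
    Submodule.span 𝕜 (Set.range fun g : inDegree 𝓥 G d => (decomposables 𝓣 N).mkQ g) =
      (N.restrictScalars 𝕜 ⊓ 𝓥 d).map (decomposables 𝓣 N).mkQ := by
  apply le_antisymm
  · refine Submodule.span_le.2 ?_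
    rintro _ ⟨⟨g, hg⟩, rfl⟩
    exact ⟨g, ⟨hN ▸ Submodule.subset_span hg.1, hg.2⟩, rfl⟩
  · rintro _ ⟨v, ⟨hv, hd⟩, rfl⟩
    obtain ⟨a, ha, b, hb, rfl⟩ := Submodule.mem_sup.1
      (H.mem_span_inDegree_sup hG (hN.symm ▸ hv : v ∈ Submodule.span T G) hd)
    have hb0 : (decomposables 𝓣 N).mkQ b = 0 := by
      rw [← LinearMap.mem_ker, Submodule.ker_mkQ, ← hN]; exact hb
    rw [map_add, hb0, add_zero,
      show (fun g : inDegree 𝓥 G d => (decomposables 𝓣 N).mkQ g) =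
      (decomposables 𝓣 N).mkQ ∘ Subtype.val from rfl, Set.range_comp, Submodule.span_image,
      Subtype.range_coe]
    exact ⟨a, ha, rfl⟩

/-- The elements of degree `d` form a basis of the image of `N_d` modulo decomposables. That space
does not involve `G`, which is why `b_d` is an invariant. -/
theorem mk_inDegree (H : IsGradedAction 𝓣 𝓥 π) {N : Submodule T V} {G : Set V}
    (hG : IsMinimalBasis 𝓥 N G) (d : ℕ) :
    Cardinal.mk (inDegree 𝓥 G d) =
      Module.rank 𝕜 ((N.restrictScalars 𝕜 ⊓ 𝓥 d).map (decomposables 𝓣 N).mkQ) := by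
  have hli := H.linearIndependent_inDegree hG d
  rw [← H.span_inDegree hG.homogeneous hG.span_eq d, rank_span hli,
    Cardinal.mk_range_eq _ hli.injective]

theorem finite_inDegree_of_fg (H : IsGradedAction 𝓣 𝓥 π) {N : Submodule T V} {G : Set V}
    (hG : IsMinimalBasis 𝓥 N G) {d : ℕ} (hd : (𝓥 d).FG) : (inDegree 𝓥 G d).Finite := by
  have : Module.Finite 𝕜 (𝓥 d) := Module.Finite.iff_fg.2 hd
  have : Module.Finite 𝕜 ((N.restrictScalars 𝕜 ⊓ 𝓥 d : Submodule 𝕜 V)) :=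
    Submodule.finiteDimensional_inf_right _ _
  rw [← Set.finite_coe_iff, ← Cardinal.lt_aleph0_iff_finite, H.mk_inDegree hG d]
  exact Module.rank_lt_aleph0 _ _

/-- Any homogeneous generating set, minimal or not, spans the image of `N_d` modulo decomposables.
This serves `C`, where the ambient components need not be finite dimensional. -/
theorem finite_inDegree_of_finite_generators (H : IsGradedAction 𝓣 𝓥 π) {N : Submodule T V}
    {G X : Set V} (hG : IsMinimalBasis 𝓥 N G) (hX : ∀ x ∈ X, ∃ e, x ∈ 𝓥 e)
    (hXN : Submodule.span T X = N) (hfin : X.Finite) (d : ℕ) : (inDegree 𝓥 G d).Finite := by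
  rw [← Set.finite_coe_iff, ← Cardinal.lt_aleph0_iff_finite, H.mk_inDegree hG d,
    ← H.span_inDegree hX hXN d]
  have : Finite (inDegree 𝓥 X d) := (hfin.subset fun x hx => hx.1).to_subtype
  have := FiniteDimensional.span_of_finite 𝕜
    (Set.finite_range fun g : inDegree 𝓥 X d => (decomposables 𝓣 N).mkQ g)
  exact Module.rank_lt_aleph0 _ _

theorem mk_inDegree_eq (H : IsGradedAction 𝓣 𝓥 π) {N : Submodule T V} {G G' : Set V}
    (hG : IsMinimalBasis 𝓥 N G) (hG' : IsMinimalBasis 𝓥 N G') (d : ℕ) :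
    Cardinal.mk (inDegree 𝓥 G d) = Cardinal.mk (inDegree 𝓥 G' d) := by
  rw [H.mk_inDegree hG, H.mk_inDegree hG']

/-- Lifts of bases of the images of all `N_d` modulo decomposables form a minimal basis: they
generate by induction on the degree, and a redundancy would be a linear dependence in one degree. -/
theorem exists_isMinimalBasis (H : IsGradedAction 𝓣 𝓥 π) {N : Submodule T V}
    (hN : ∀ v ∈ N, ∀ d, π d v ∈ N) : ∃ G, IsMinimalBasis 𝓥 N G := by
  set q := (decomposables 𝓣 N).mkQ with hq
  have hker : ∀ v, q v = 0 ↔ v ∈ decomposables 𝓣 N := fun v => by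
    rw [← LinearMap.mem_ker, Submodule.ker_mkQ]
  choose κ a ha hspan hli using fun d => exists_linearIndependent' 𝕜
    (fun v : (N.restrictScalars 𝕜 ⊓ 𝓥 d : Submodule 𝕜 V) => q v)
  let G : Set V := {v | ∃ d, ∃ i : κ d, v = a d i}
  have hGN : G ⊆ N := by
    rintro _ ⟨d, i, rfl⟩
    exact (a d i).2.1
  have hGh : ∀ x ∈ G, ∃ e, x ∈ 𝓥 e := by
    rintro _ ⟨d, i, rfl⟩
    exact ⟨d, (a d i).2.2⟩
  have hGspan : Submodule.span T G ≤ N := Submodule.span_le.2 hGN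
  have hdeg : ∀ d, ∀ v ∈ N, v ∈ 𝓥 d → v ∈ Submodule.span T G := by
    intro d
    induction d using Nat.strong_induction_on with
    | _ d ih =>
      intro v hv hvd
      have h1 : q v ∈ Submodule.span 𝕜 (Set.range ((fun v :
          (N.restrictScalars 𝕜 ⊓ 𝓥 d : Submodule 𝕜 V) => q v) ∘ a d)) := by
        rw [hspan]
        exact Submodule.subset_span ⟨⟨v, hv, hvd⟩, rfl⟩
      rw [show ((fun v : (N.restrictScalars 𝕜 ⊓ 𝓥 d : Submodule 𝕜 V) => q v) ∘ a d) =
        q ∘ (fun i => (a d i : V)) from rfl, Set.range_comp, Submodule.span_image] at h1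
      obtain ⟨z, hz, hzv⟩ := h1
      have hzG : z ∈ Submodule.span T G := by
        refine span_le_restrictScalars_span _ (Submodule.span_mono ?_ hz)
        rintro _ ⟨i, rfl⟩
        exact ⟨d, i, rfl⟩
      have hy : v - z ∈ decomposables 𝓣 N := by
        rw [← hker, map_sub, hzv, sub_self]
      have hzd : z ∈ 𝓥 d := by
        refine Submodule.span_le.2 ?_ hz
        rintro _ ⟨i, rfl⟩
        exact (a d i).2.2
      -- With all homogeneous elements of `N` as generators, `v - z` comes from elements of `N` of
      -- degree below `d`, to which the induction hypothesis applies.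
      have hN' : N = Submodule.span T {x | x ∈ N ∧ ∃ e, x ∈ 𝓥 e} := by
        apply le_antisymm
        · intro x hx
          refine Submodule.span_le.2 ?_ (span_le_restrictScalars_span (T := T) _
            (H.mem_span_proj x).1)
          rintro _ ⟨e, rfl⟩
          exact Submodule.subset_span ⟨hN x hx e, e, (H.mem_span_proj x).2 e⟩
        · exact Submodule.span_le.2 fun x hx => hx.1
      rw [hN'] at hy
      have h2 := H.proj_decomposables_mem (fun x hx => hx.2) hy d
      rw [H.proj_same (Submodule.sub_mem _ hvd hzd)] at h2
      have h3 : v - z ∈ Submodule.span T G := by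
        refine Submodule.span_le.2 ?_ h2
        rintro x ⟨⟨hx, -⟩, e, he, hxe⟩
        exact ih e he x hx hxe
      simpa using add_mem h3 hzG
  have hspanG : Submodule.span T G = N := by
    refine le_antisymm hGspan fun x hx => ?_
    refine Submodule.span_le.2 ?_ (span_le_restrictScalars_span (T := T) _
      (H.mem_span_proj x).1)
    rintro _ ⟨e, rfl⟩
    exact hdeg e _ (hN x hx e) ((H.mem_span_proj x).2 e)
  refine ⟨G, hGh, hspanG, ?_⟩
  rintro _ ⟨d, i, rfl⟩ hmem
  obtain ⟨z, hz, y, hy, hzy⟩ := Submodule.mem_sup.1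
    (H.mem_span_inDegree_sup (fun x hx => hGh x hx.1) hmem (a d i).2.2)
  have hy' : q y = 0 := (hker y).2 (decomposables_mono
    ((Submodule.span_mono Set.sdiff_subset).trans hGspan) hy)
  refine (linearIndependent_iff_notMem_span.1 (hli d)) i ?_
  change q (a d i) ∈ _
  rw [← hzy, map_add, hy', add_zero,
    show ((fun v : (N.restrictScalars 𝕜 ⊓ 𝓥 d : Submodule 𝕜 V) => q v) ∘ a d) =
        q ∘ (fun i => (a d i : V)) from rfl, Set.image_comp, Submodule.span_image]
  refine ⟨z, Submodule.span_mono ?_ hz, rfl⟩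
  rintro _ ⟨⟨⟨e, k, rfl⟩, hne⟩, hd⟩
  -- A lift from another degree `e` lying in `𝓥 d` would be zero, against linear independence.
  have hek : e = d := by
    by_contra hed
    refine (hli e).ne_zero k ?_
    change q (a e k) = 0
    rw [H.eq_zero hd (a e k).2.2 hed, map_zero]
  subst hek
  exact ⟨k, ⟨trivial, fun h => hne (by rw [Set.mem_singleton_iff.1 h]; rfl)⟩, rfl⟩

end IsGradedAction

end

end GradedMinimalBases

end Letterplace

namespace Letterplace

open scoped TensorProduct

/-! ### Words and their monomials from an arbitrary starting place. -/

section Words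

variable (𝕜 : Type*) [Field 𝕜] {n : ℕ}

/-- The word `w` as an element of the free algebra. -/
def word (w : List (Fin n)) : F 𝕜 n := (w.map (FreeAlgebra.ι 𝕜)).prod

@[simp] theorem word_nil : word 𝕜 ([] : List (Fin n)) = 1 := rfl

@[simp] theorem word_cons (i : Fin n) (w : List (Fin n)) :
    word 𝕜 (i :: w) = FreeAlgebra.ι 𝕜 i * word 𝕜 w := by simp [word]

theorem word_append (v w : List (Fin n)) : word 𝕜 (v ++ w) = word 𝕜 v * word 𝕜 w := by
  simp [word]

theorem basisFreeMonoid_apply (w : FreeMonoid (Fin n)) :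
    FreeAlgebra.basisFreeMonoid 𝕜 (Fin n) w = word 𝕜 w.toList := by
  simp [FreeAlgebra.basisFreeMonoid, FreeAlgebra.equivMonoidAlgebraFreeMonoid, word,
    FreeMonoid.lift_apply]

theorem span_range_word : Submodule.span 𝕜 (Set.range (word 𝕜 (n := n))) = ⊤ := by
  rw [← (FreeAlgebra.basisFreeMonoid 𝕜 (Fin n)).span_eq]
  congr 1
  ext f
  constructor
  · rintro ⟨w, rfl⟩
    exact ⟨FreeMonoid.ofList w, by rw [basisFreeMonoid_apply]; rfl⟩
  · rintro ⟨w, rfl⟩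
    exact ⟨w.toList, (basisFreeMonoid_apply 𝕜 w).symm⟩

theorem word_mem_pieceF (w : List (Fin n)) : word 𝕜 w ∈ pieceF 𝕜 n w.length :=
  Submodule.subset_span ⟨w, rfl, rfl⟩

variable {𝕜} in
@[elab_as_elim]
theorem pieceF_induction {d : ℕ} {motive : F 𝕜 n → Prop} {f : F 𝕜 n} (hf : f ∈ pieceF 𝕜 n d)
    (word : ∀ w : List (Fin n), w.length = d → motive (word 𝕜 w)) (zero : motive 0)
    (add : ∀ f g, motive f → motive g → motive (f + g))
    (smul : ∀ (c : 𝕜) f, motive f → motive (c • f)) : motive f := by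
  induction hf using Submodule.span_induction with
  | mem f hf =>
    obtain ⟨w, hw, rfl⟩ := hf
    exact word w hw
  | zero => exact zero
  | add f g _ _ hf hg => exact add f g hf hg
  | smul c f _ hf => exact smul c f hf

variable {𝕜} in
@[elab_as_elim]
theorem monomial_induction {motive : P 𝕜 n → Prop} (p : P 𝕜 n)
    (monomial : ∀ e, motive (MvPolynomial.monomial e 1))
    (add : ∀ f g, motive f → motive g → motive (f + g))
    (smul : ∀ (c : 𝕜) f, motive f → motive (c • f)) : motive p := by
  induction p using MvPolynomial.induction_on' with
  | monomial e c =>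
    have := smul c _ (monomial e)
    rwa [MvPolynomial.smul_monomial, smul_eq_mul, mul_one] at this
  | add p q hp hq => exact add p q hp hq

/-- The monomial `x_{i₁ k} x_{i₂ k+1} ⋯` attached to a word, starting at place `k`. -/
noncomputable def wordMonomialFrom (k : ℕ) (w : List (Fin n)) : P 𝕜 n :=
  ((w.zipIdx k).map (fun p => MvPolynomial.X p)).prod

@[simp] theorem wordMonomialFrom_nil (k : ℕ) :
    wordMonomialFrom 𝕜 k ([] : List (Fin n)) = 1 := rfl

@[simp] theorem wordMonomialFrom_cons (k : ℕ) (i : Fin n) (w : List (Fin n)) :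
    wordMonomialFrom 𝕜 k (i :: w) = MvPolynomial.X (i, k) * wordMonomialFrom 𝕜 (k + 1) w := by
  simp [wordMonomialFrom, List.zipIdx_cons]

theorem wordMonomialFrom_append (k : ℕ) (v w : List (Fin n)) :
    wordMonomialFrom 𝕜 k (v ++ w) =
      wordMonomialFrom 𝕜 k v * wordMonomialFrom 𝕜 (k + v.length) w := by
  induction v generalizing k with
  | nil => simp
  | cons i v ih => simp [ih, mul_assoc, add_assoc, add_comm 1]

theorem shiftP_wordMonomialFrom (k : ℕ) (w : List (Fin n)) :
    shiftP 𝕜 n (wordMonomialFrom 𝕜 k w) = wordMonomialFrom 𝕜 (k + 1) w := by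
  induction w generalizing k with
  | nil => simp
  | cons i v ih =>
    rw [wordMonomialFrom_cons, map_mul, ih, wordMonomialFrom_cons]
    simp [shiftP]

theorem wordMonomialFrom_mem_supported (k : ℕ) (w : List (Fin n)) :
    wordMonomialFrom 𝕜 k w ∈ MvPolynomial.supported 𝕜 {q : Fin n × ℕ | k ≤ q.2} := by
  induction w generalizing k with
  | nil => simp
  | cons i v ih =>
    rw [wordMonomialFrom_cons]
    refine mul_mem (MvPolynomial.X_mem_supported.2 (le_refl k))
      (MvPolynomial.supported_mono ?_ (ih (k + 1)))
    intro q hq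
    exact (Nat.le_succ k).trans hq

/-- The linear map `F → P` sending a word to its monomial starting at place `k`. -/
noncomputable def iotaP (k : ℕ) : F 𝕜 n →ₗ[𝕜] P 𝕜 n :=
  (FreeAlgebra.basisFreeMonoid 𝕜 (Fin n)).constr 𝕜 (fun w => wordMonomialFrom 𝕜 k w.toList)

@[simp] theorem iotaP_word (k : ℕ) (w : List (Fin n)) :
    iotaP 𝕜 k (word 𝕜 w) = wordMonomialFrom 𝕜 k w := by
  rw [show word 𝕜 w = FreeAlgebra.basisFreeMonoid 𝕜 (Fin n) (FreeMonoid.ofList w) by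
    rw [basisFreeMonoid_apply]; rfl, iotaP, Module.Basis.constr_basis]
  rfl

@[simp] theorem iotaF_word (w : List (Fin n)) :
    iotaF 𝕜 n (word 𝕜 w) = Ideal.Quotient.mkₐ 𝕜 (Q 𝕜 n) (wordMonomialFrom 𝕜 0 w) := by
  rw [show word 𝕜 w = FreeAlgebra.basisFreeMonoid 𝕜 (Fin n) (FreeMonoid.ofList w) by
    rw [basisFreeMonoid_apply]; rfl, iotaF, Module.Basis.constr_basis]
  rfl

variable {𝕜}

theorem linearMap_ext_word {M : Type*} [AddCommGroup M] [Module 𝕜 M] {f g : F 𝕜 n →ₗ[𝕜] M}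
    (h : ∀ w, f (word 𝕜 w) = g (word 𝕜 w)) : f = g :=
  LinearMap.ext_on_range (span_range_word 𝕜) h

theorem iotaP_mem_supported (k : ℕ) (f : F 𝕜 n) :
    iotaP 𝕜 k f ∈ MvPolynomial.supported 𝕜 {q : Fin n × ℕ | k ≤ q.2} := by
  have : f ∈ Submodule.span 𝕜 (Set.range (word 𝕜 (n := n))) :=
    span_range_word 𝕜 ▸ Submodule.mem_top
  induction this using Submodule.span_induction with
  | mem f hf =>
    obtain ⟨w, rfl⟩ := hf
    rw [iotaP_word]
    exact wordMonomialFrom_mem_supported 𝕜 k w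
  | zero => rw [map_zero]; exact zero_mem _
  | add f g _ _ hf hg => rw [map_add]; exact add_mem hf hg
  | smul c f _ hf => rw [map_smul]; exact Subalgebra.smul_mem _ hf c

theorem sigmaR_iterate_iotaF (k : ℕ) (f : F 𝕜 n) :
    (sigmaR 𝕜 n)^[k] (iotaF 𝕜 n f) = Ideal.Quotient.mkₐ 𝕜 (Q 𝕜 n) (iotaP 𝕜 k f) := by
  suffices h : ((sigmaR 𝕜 n).toLinearMap ^ k) ∘ₗ iotaF 𝕜 n =
      (Ideal.Quotient.mkₐ 𝕜 (Q 𝕜 n)).toLinearMap ∘ₗ iotaP 𝕜 k by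
    have := LinearMap.congr_fun h f
    rw [LinearMap.comp_apply, Module.End.pow_apply] at this
    exact this
  refine linearMap_ext_word fun w => ?_
  rw [LinearMap.comp_apply, Module.End.pow_apply, iotaF_word, LinearMap.comp_apply, iotaP_word]
  induction k with
  | zero => rfl
  | succ k ih =>
    rw [Function.iterate_succ_apply', ih]
    exact congrArg (Ideal.Quotient.mkₐ 𝕜 (Q 𝕜 n)) (shiftP_wordMonomialFrom 𝕜 k w)

/-- Homogeneity of the left factor is essential: its degree decides at which place the right factor
starts. -/
theorem iotaP_mul {t : ℕ} {a : F 𝕜 n} (ha : a ∈ pieceF 𝕜 n t) (k : ℕ) (b : F 𝕜 n) :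
    iotaP 𝕜 k (a * b) = iotaP 𝕜 k a * iotaP 𝕜 (k + t) b := by
  suffices h : iotaP 𝕜 k ∘ₗ LinearMap.mulLeft 𝕜 a =
      LinearMap.mulLeft 𝕜 (iotaP 𝕜 k a) ∘ₗ iotaP 𝕜 (k + t) from LinearMap.congr_fun h b
  refine linearMap_ext_word fun w => ?_
  simp only [LinearMap.comp_apply, LinearMap.mulLeft_apply, iotaP_word]
  refine pieceF_induction ha (fun v hv => ?_) ?_ (fun f g hf hg => ?_) (fun c f hf => ?_)
  · rw [← word_append, iotaP_word, wordMonomialFrom_append, iotaP_word, hv]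
  · simp
  · rw [add_mul, map_add, hf, hg, map_add, add_mul]
  · rw [smul_mul_assoc, map_smul, hf, map_smul, smul_mul_assoc]

theorem exists_eq_algebraMap_of_mem_pieceF_zero {f : F 𝕜 n} (hf : f ∈ pieceF 𝕜 n 0) :
    ∃ c : 𝕜, f = algebraMap 𝕜 (F 𝕜 n) c := by
  refine pieceF_induction hf (fun w hw => ?_) ?_ (fun f g hf hg => ?_) (fun c f hf => ?_)
  · exact ⟨1, by rw [List.eq_nil_of_length_eq_zero hw, map_one]; rfl⟩
  · exact ⟨0, (map_zero _).symm⟩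
  · obtain ⟨a, rfl⟩ := hf
    obtain ⟨b, rfl⟩ := hg
    exact ⟨a + b, (map_add _ _ _).symm⟩
  · obtain ⟨a, rfl⟩ := hf
    exact ⟨c * a, by rw [map_mul, Algebra.smul_def]⟩

end Words

/-! ### Relations of `S` and a vanishing criterion on the kernel of `P → S`. -/

section Quotients

variable {𝕜 : Type*} [Field 𝕜] {n : ℕ} (I : Ideal (F 𝕜 n))

/-- A shortcut for the ring structure of `S`. -/
noncomputable abbrev S.commRing : CommRing (S I) := Ideal.Quotient.commRing (J I)

attribute [local instance] S.commRing

/-- The quotient map `P → S`. -/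
noncomputable def toS : P 𝕜 n →ₐ[𝕜] S I :=
  (Ideal.Quotient.mkₐ 𝕜 (J I)).comp (Ideal.Quotient.mkₐ 𝕜 (Q 𝕜 n))

theorem toS_surjective : Function.Surjective (toS I) :=
  (Ideal.Quotient.mkₐ_surjective 𝕜 _).comp (Ideal.Quotient.mkₐ_surjective 𝕜 _)

theorem toS_X (i : Fin n) (j : ℕ) : toS I (MvPolynomial.X (i, j)) = x I i j := rfl

theorem toS_X_mul_X (i k : Fin n) (j : ℕ) :
    toS I (MvPolynomial.X (i, j) * MvPolynomial.X (k, j)) = 0 := by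
  have : Ideal.Quotient.mkₐ 𝕜 (Q 𝕜 n) (MvPolynomial.X (i, j) * MvPolynomial.X (k, j)) = 0 :=
    Ideal.Quotient.eq_zero_iff_mem.2 (Ideal.subset_span ⟨i, k, j, rfl⟩)
  rw [toS, AlgHom.comp_apply, this, map_zero]

theorem x_mul_x (i k : Fin n) (j : ℕ) : x I i j * x I k j = 0 := by
  rw [← toS_X, ← toS_X, ← map_mul, toS_X_mul_X]

theorem toS_iotaP_of_mem {f : F 𝕜 n} (hf : f ∈ I) (k : ℕ) : toS I (iotaP 𝕜 k f) = 0 := by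
  rw [toS, AlgHom.comp_apply, ← sigmaR_iterate_iotaF]
  exact Ideal.Quotient.eq_zero_iff_mem.2 (Ideal.subset_span (Set.mem_iUnion.2 ⟨k, f, hf, rfl⟩))

/-- The linear span of the kernel of `P → S` is generated by `Q` and the shifts of `ι(I)`: a
linear map vanishing on the corresponding products vanishes on the kernel. -/
theorem eq_zero_of_toS_eq_zero {M : Type*} [AddCommGroup M] [Module 𝕜 M] (ψ : P 𝕜 n →ₗ[𝕜] M)
    (hI : IsGraded I)
    (hQ : ∀ i k j p, ψ (MvPolynomial.X (i, j) * MvPolynomial.X (k, j) * p) = 0)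
    (hJ : ∀ (d k : ℕ), ∀ f ∈ I, f ∈ pieceF 𝕜 n d → ∀ p, ψ (iotaP 𝕜 k f * p) = 0)
    {p : P 𝕜 n} (hp : toS I p = 0) : ψ p = 0 := by
  -- Since `ψ` is only linear, an arbitrary cofactor is carried along to absorb ideal coefficients.
  have hQ' : ∀ p ∈ Q 𝕜 n, ∀ q, ψ (p * q) = 0 := by
    intro p hp
    induction hp using Submodule.span_induction with
    | mem p hp =>
      obtain ⟨i, k, j, rfl⟩ := hp
      exact hQ i k j
    | zero => simp
    | add p p' _ _ hp hp' => intro q; rw [add_mul, map_add, hp, hp', add_zero]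
    | smul c p _ hp => intro q; rw [smul_eq_mul, mul_comm c, mul_assoc, hp]
  have hJ' : ∀ k, ∀ f ∈ I, ∀ p, ψ (iotaP 𝕜 k f * p) = 0 := by
    intro k f hf p
    -- Gradedness of `I` reduces the relations to homogeneous ones.
    have hf' : f ∈ ⨆ d : ℕ, I.restrictScalars 𝕜 ⊓ pieceF 𝕜 n d := hI ▸ hf
    refine Submodule.iSup_induction _
      (motive := fun f => ψ (iotaP 𝕜 k f * p) = 0) hf' (fun d f hf => hJ d k f hf.1 hf.2 p) ?_
      fun f g hf hg => ?_
    · simp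
    · rw [map_add, add_mul, map_add, hf, hg, add_zero]
  have hmk : ∀ p q, Ideal.Quotient.mk (Q 𝕜 n) p = Ideal.Quotient.mk (Q 𝕜 n) q →
      ∀ r, ψ (p * r) = ψ (q * r) := by
    intro p q h r
    rw [← sub_eq_zero, ← map_sub, ← sub_mul]
    exact hQ' _ (Ideal.Quotient.eq.1 h) r
  have key : ∀ r ∈ J I, ∀ p, Ideal.Quotient.mk (Q 𝕜 n) p = r → ∀ q, ψ (p * q) = 0 := by
    intro r hr
    induction hr using Submodule.span_induction with
    | mem r hr =>
      obtain ⟨k, f, hf, rfl⟩ := Set.mem_iUnion.1 hr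
      intro p hp q
      rw [hmk p (iotaP 𝕜 k f) (hp.trans (sigmaR_iterate_iotaF k f)), hJ' k f hf]
    | zero =>
      intro p hp q
      rw [hmk p 0 (hp.trans (map_zero _).symm), zero_mul, map_zero]
    | add a b _ _ ha hb =>
      intro p hp q
      obtain ⟨pa, rfl⟩ := Ideal.Quotient.mk_surjective a
      obtain ⟨pb, rfl⟩ := Ideal.Quotient.mk_surjective b
      rw [hmk p (pa + pb) (hp.trans (map_add _ _ _).symm), add_mul, map_add, ha pa rfl,
        hb pb rfl, add_zero]
    | smul c a _ ha =>
      intro p hp q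
      obtain ⟨pa, rfl⟩ := Ideal.Quotient.mk_surjective a
      obtain ⟨pc, rfl⟩ := Ideal.Quotient.mk_surjective c
      rw [hmk p (pa * pc) (hp.trans (by rw [smul_eq_mul, map_mul, mul_comm])), mul_assoc,
        ha pa rfl]
  have := key _ (Ideal.Quotient.eq_zero_iff_mem.1 hp) p rfl 1
  rwa [mul_one] at this

end Quotients

end Letterplace

namespace Letterplace

open scoped TensorProduct

/-! ### The initial run of consecutive occupied places of a monomial. -/

section LeadingWord

variable {n : ℕ}

/-- `LeadingWord Δ e u e'`: the monomial with exponent `e` is the monomial of the word `u` starting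
at place `Δ`, times a monomial with exponent `e'` in places beyond the first unused one. -/
inductive LeadingWord :
    ℕ → (Fin n × ℕ →₀ ℕ) → List (Fin n) → (Fin n × ℕ →₀ ℕ) → Prop
  | nil (Δ : ℕ) (e : Fin n × ℕ →₀ ℕ) (h : ∀ q, e q ≠ 0 → Δ < q.2) : LeadingWord Δ e [] e
  | cons (Δ : ℕ) (i : Fin n) (e : Fin n × ℕ →₀ ℕ) (u : List (Fin n)) (e' : Fin n × ℕ →₀ ℕ)
      (h : LeadingWord (Δ + 1) e u e') :
      LeadingWord Δ (Finsupp.single (i, Δ) 1 + e) (i :: u) e'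

theorem LeadingWord.le {Δ : ℕ} {e e' : Fin n × ℕ →₀ ℕ} {u : List (Fin n)}
    (h : LeadingWord Δ e u e') : ∀ q, e q ≠ 0 → Δ ≤ q.2 := by
  induction h with
  | nil Δ e h => exact fun q hq => (h q hq).le
  | cons Δ i e u e' h ih =>
    intro q hq
    rcases eq_or_ne q (i, Δ) with rfl | hne
    · exact le_rfl
    · refine (Nat.le_succ Δ).trans (ih q ?_)
      rwa [Finsupp.add_apply, Finsupp.single_eq_of_ne hne, zero_add] at hq

/-- Place `Δ` is occupied, so the run is nonempty; everything after its first letter sits in later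
places, so that letter must be `i`. -/
theorem LeadingWord.exists_of_single_add {Δ : ℕ} {i : Fin n} {e e' : Fin n × ℕ →₀ ℕ}
    {u : List (Fin n)} (h : LeadingWord Δ (Finsupp.single (i, Δ) 1 + e) u e') :
    ∃ v, u = i :: v ∧ LeadingWord (Δ + 1) e v e' := by
  generalize hE : Finsupp.single (i, Δ) 1 + e = E at h
  cases h with
  | nil _ _ h =>
    exfalso
    refine lt_irrefl Δ (h (i, Δ) ?_)
    rw [← hE, Finsupp.add_apply, Finsupp.single_eq_same]
    omega
  | cons _ k e₁ v _ h =>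
    have hki : i = k := by
      by_contra hne
      have h0 : e₁ (i, Δ) = 0 := by
        by_contra h0
        have : Δ + 1 ≤ Δ := h.le _ h0
        omega
      have h1 := DFunLike.congr_fun hE (i, Δ)
      rw [Finsupp.add_apply, Finsupp.single_eq_same, Finsupp.add_apply, h0,
        Finsupp.single_eq_of_ne (fun h => hne (congrArg Prod.fst h))] at h1
      omega
    subst hki
    rw [add_left_cancel hE]
    exact ⟨v, rfl, h⟩

theorem LeadingWord.unique {Δ : ℕ} {e e' e'' : Fin n × ℕ →₀ ℕ} {u v : List (Fin n)}
    (h : LeadingWord Δ e u e') (h' : LeadingWord Δ e v e'') : u = v ∧ e' = e'' := by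
  induction h generalizing v with
  | nil Δ e h =>
    cases h' with
    | nil => exact ⟨rfl, rfl⟩
    | cons _ i e₁ _ _ h₁ =>
      exact absurd (h (i, Δ) (by rw [Finsupp.add_apply, Finsupp.single_eq_same]; omega))
        (lt_irrefl Δ)
  | cons Δ i e u e' h ih =>
    obtain ⟨w, rfl, hw⟩ := h'.exists_of_single_add
    obtain ⟨rfl, rfl⟩ := ih hw
    exact ⟨rfl, rfl⟩

end LeadingWord

/-! ### Splitting off the initial run: a linear map from `S` to `A ⊗ S`. -/

section Factorization

attribute [local instance] S.commRing

variable {𝕜 : Type*} [Field 𝕜] {n : ℕ} (I : Ideal (F 𝕜 n)) [I.IsTwoSided]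

/-- The quotient map `F → A`. -/
noncomputable def toA : F 𝕜 n →ₐ[𝕜] A I := Ideal.Quotient.mkₐ 𝕜 I

theorem toA_surjective : Function.Surjective (toA I) := Ideal.Quotient.mkₐ_surjective 𝕜 _

theorem toA_eq_zero {f : F 𝕜 n} (hf : f ∈ I) : toA I f = 0 :=
  Ideal.Quotient.eq_zero_iff_mem.2 hf

open Classical in
/-- The value `u ⊗ e'` of the factorization map on a monomial with `LeadingWord Δ e u e'`. -/
noncomputable def factorMonomial (Δ : ℕ) (e : Fin n × ℕ →₀ ℕ) : A I ⊗[𝕜] S I :=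
  if h : ∃ q : List (Fin n) × (Fin n × ℕ →₀ ℕ), LeadingWord Δ e q.1 q.2 then
    toA I (word 𝕜 h.choose.1) ⊗ₜ toS I (MvPolynomial.monomial h.choose.2 1)
  else 0

theorem factorMonomial_eq {Δ : ℕ} {e e' : Fin n × ℕ →₀ ℕ} {u : List (Fin n)}
    (h : LeadingWord Δ e u e') : factorMonomial I Δ e =
      toA I (word 𝕜 u) ⊗ₜ toS I (MvPolynomial.monomial e' 1) := by
  have hex : ∃ q : List (Fin n) × (Fin n × ℕ →₀ ℕ), LeadingWord Δ e q.1 q.2 := ⟨(u, e'), h⟩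
  rw [factorMonomial, dif_pos hex]
  obtain ⟨h1, h2⟩ := h.unique hex.choose_spec
  rw [← h1, ← h2]

theorem factorMonomial_eq_zero {Δ : ℕ} {e : Fin n × ℕ →₀ ℕ}
    (h : ∀ u e', ¬ LeadingWord Δ e u e') : factorMonomial I Δ e = 0 :=
  dif_neg fun ⟨q, hq⟩ => h q.1 q.2 hq

/-- The factorization map on `P`. -/
noncomputable def factorP (Δ : ℕ) : P 𝕜 n →ₗ[𝕜] A I ⊗[𝕜] S I :=
  (MvPolynomial.basisMonomials (Fin n × ℕ) 𝕜).constr 𝕜 (factorMonomial I Δ)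

theorem factorP_monomial (Δ : ℕ) (e : Fin n × ℕ →₀ ℕ) :
    factorP I Δ (MvPolynomial.monomial e 1) = factorMonomial I Δ e := by
  have := (MvPolynomial.basisMonomials (Fin n × ℕ) 𝕜).constr_basis 𝕜 (factorMonomial I Δ) e
  rwa [MvPolynomial.coe_basisMonomials] at this

theorem X_mul_monomial_one (q : Fin n × ℕ) (e : Fin n × ℕ →₀ ℕ) :
    (MvPolynomial.X q * MvPolynomial.monomial e 1 : P 𝕜 n) =
      MvPolynomial.monomial (Finsupp.single q 1 + e) 1 := by
  rw [MvPolynomial.X, MvPolynomial.monomial_mul, mul_one]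

theorem factorP_X_mul_of_lt {Δ j : ℕ} (hj : j < Δ) (i : Fin n) (p : P 𝕜 n) :
    factorP I Δ (MvPolynomial.X (i, j) * p) = 0 := by
  induction p using monomial_induction with
  | monomial e =>
    rw [X_mul_monomial_one, factorP_monomial]
    refine factorMonomial_eq_zero I fun u e' h => ?_
    have : Δ ≤ j := h.le (i, j) (by rw [Finsupp.add_apply, Finsupp.single_eq_same]; omega)
    omega
  | add f g hf hg => rw [mul_add, map_add, hf, hg, add_zero]
  | smul c f hf => rw [mul_smul_comm, map_smul, hf, smul_zero]

/-- A variable in place `Δ` prefixes a letter to the run starting at `Δ + 1`; if no such run exists,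
both sides vanish. -/
theorem factorP_X_mul (Δ : ℕ) (i : Fin n) (p : P 𝕜 n) :
    factorP I Δ (MvPolynomial.X (i, Δ) * p) =
      toA I (FreeAlgebra.ι 𝕜 i) • factorP I (Δ + 1) p := by
  induction p using monomial_induction with
  | monomial e =>
    rw [X_mul_monomial_one, factorP_monomial, factorP_monomial]
    by_cases h : ∃ u e', LeadingWord (Δ + 1) e u e'
    · obtain ⟨u, e', h⟩ := h
      rw [factorMonomial_eq I h, factorMonomial_eq I (h.cons _ i), word_cons, map_mul,
        TensorProduct.smul_tmul', smul_eq_mul]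
    · push Not at h
      rw [factorMonomial_eq_zero I h, smul_zero]
      refine factorMonomial_eq_zero I fun u e' h' => ?_
      obtain ⟨v, -, hv⟩ := h'.exists_of_single_add
      exact h v e' hv
  | add f g hf hg => rw [mul_add, map_add, hf, hg, map_add, smul_add]
  | smul c f hf => rw [mul_smul_comm, map_smul, hf, map_smul, smul_comm]

theorem factorP_of_mem_supported {Δ : ℕ} {p : P 𝕜 n}
    (hp : p ∈ MvPolynomial.supported 𝕜 {q : Fin n × ℕ | Δ < q.2}) :
    factorP I Δ p = 1 ⊗ₜ toS I p := by
  rw [MvPolynomial.mem_supported] at hp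
  suffices h : ∀ e ∈ p.support, factorP I Δ (MvPolynomial.monomial e (p.coeff e)) =
      1 ⊗ₜ toS I (MvPolynomial.monomial e (p.coeff e)) by
    conv_lhs => rw [p.as_sum]
    conv_rhs => rw [p.as_sum]
    rw [map_sum, map_sum, TensorProduct.tmul_sum]
    exact Finset.sum_congr rfl h
  intro e he
  rw [← mul_one (p.coeff e), ← smul_eq_mul, ← MvPolynomial.smul_monomial, map_smul, map_smul,
    factorP_monomial, factorMonomial_eq I (LeadingWord.nil Δ e fun q hq => hp
      ((MvPolynomial.mem_vars_iff_mem_support q).2 ⟨e, he, Finsupp.mem_support_iff.2 hq⟩)),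
    word_nil, map_one, TensorProduct.tmul_smul]

theorem smul_assoc_tensor (c : 𝕜) (a : A I) (z : A I ⊗[𝕜] S I) : (c • a) • z = c • (a • z) := by
  induction z using TensorProduct.induction_on with
  | zero => rw [smul_zero, smul_zero, smul_zero]
  | tmul b y => rw [TensorProduct.smul_tmul', TensorProduct.smul_tmul', TensorProduct.smul_tmul',
      smul_assoc]
  | add y z hy hz => rw [smul_add, hy, hz, smul_add, smul_add]

theorem factorP_iotaP_mul {Δ t : ℕ} {f : F 𝕜 n} (hf : f ∈ pieceF 𝕜 n t) (p : P 𝕜 n) :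
    factorP I Δ (iotaP 𝕜 Δ f * p) = toA I f • factorP I (Δ + t) p := by
  refine pieceF_induction hf (fun w hw => ?_) ?_ (fun f g hf hg => ?_) (fun c f hf => ?_)
  · subst hw
    rw [iotaP_word]
    clear hf
    induction w generalizing Δ with
    | nil => simp
    | cons i w ih =>
      rw [wordMonomialFrom_cons, mul_assoc, factorP_X_mul, ih, word_cons, map_mul, mul_smul,
        List.length_cons, add_assoc, add_comm 1]
  · simp
  · rw [map_add, add_mul, map_add, hf, hg, map_add, add_smul]
  · rw [map_smul, smul_mul_assoc, map_smul, hf, map_smul, smul_assoc_tensor]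

theorem exists_eq_X_mul_of_ne_zero {e : Fin n × ℕ →₀ ℕ} {q : Fin n × ℕ} (hq : e q ≠ 0) :
    ∃ e₀, (MvPolynomial.monomial e 1 : P 𝕜 n) = MvPolynomial.X q * MvPolynomial.monomial e₀ 1 ∧
      e = Finsupp.single q 1 + e₀ := by
  have h : Finsupp.single q 1 + (e - Finsupp.single q 1) = e :=
    add_tsub_cancel_of_le (Finsupp.single_le_iff.2 (Nat.one_le_iff_ne_zero.2 hq))
  refine ⟨e - Finsupp.single q 1, ?_, h.symm⟩
  rw [X_mul_monomial_one, h]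

theorem monomial_mem_supported {s : Set (Fin n × ℕ)} {e : Fin n × ℕ →₀ ℕ}
    (h : ∀ q, e q ≠ 0 → q ∈ s) :
    (MvPolynomial.monomial e 1 : P 𝕜 n) ∈ MvPolynomial.supported 𝕜 s := by
  rw [MvPolynomial.mem_supported, MvPolynomial.vars_monomial one_ne_zero]
  intro q hq
  exact h q (Finsupp.mem_support_iff.1 hq)

/-- Either the cofactor avoids places up to `Δ`, so the run is empty and the relation `y = 0` in `S`
acts in the right tensor factor, or it has a variable in a place at most `Δ`, which gives zero or
passes to `Δ + 1`. -/
theorem factorP_mul_eq_zero_of_succ {Δ : ℕ} {y : P 𝕜 n}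
    (hy : y ∈ MvPolynomial.supported 𝕜 {q : Fin n × ℕ | Δ < q.2}) (hy0 : toS I y = 0)
    (h : ∀ p, factorP I (Δ + 1) (y * p) = 0) (p : P 𝕜 n) : factorP I Δ (y * p) = 0 := by
  induction p using monomial_induction with
  | monomial e =>
    by_cases he : ∀ q, e q ≠ 0 → Δ < q.2
    · rw [factorP_of_mem_supported I (mul_mem hy (monomial_mem_supported he)), map_mul, hy0,
        zero_mul, TensorProduct.tmul_zero]
    · push Not at he
      obtain ⟨⟨i, j⟩, hq, hj⟩ := he
      obtain ⟨e₀, h₀, -⟩ := exists_eq_X_mul_of_ne_zero (𝕜 := 𝕜) hq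
      rw [h₀, mul_left_comm]
      rcases (show j ≤ Δ from hj).lt_or_eq with hlt | rfl
      · exact factorP_X_mul_of_lt I hlt i _
      · rw [factorP_X_mul, h, smul_zero]
  | add f g hf hg => rw [mul_add, map_add, hf, hg, add_zero]
  | smul c f hf => rw [mul_smul_comm, map_smul, hf, smul_zero]

theorem factorP_mul_eq_zero_of_le {Δ k : ℕ} (hk : Δ ≤ k) {y : P 𝕜 n}
    (hy : y ∈ MvPolynomial.supported 𝕜 {q : Fin n × ℕ | k ≤ q.2}) (hy0 : toS I y = 0)
    (h : ∀ p, factorP I k (y * p) = 0) : ∀ p, factorP I Δ (y * p) = 0 := by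
  induction hk using Nat.decreasingInduction with
  | self => exact h
  | of_succ m hm ih =>
    have hs : {q : Fin n × ℕ | k ≤ q.2} ⊆ {q | m < q.2} := by
      intro q hq
      exact lt_of_lt_of_le hm hq
    exact factorP_mul_eq_zero_of_succ I (MvPolynomial.supported_mono hs hy) hy0 ih

/-- For `Δ = k` the relation acts in the left factor `A`, and descending induction handles smaller
`Δ`. For `Δ > k` and positive degree, every term has a variable in the forbidden place `k`. -/
theorem factorP_iotaP_mul_of_mem {d : ℕ} {f : F 𝕜 n} (hfI : f ∈ I) (hf : f ∈ pieceF 𝕜 n d)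
    (Δ k : ℕ) (p : P 𝕜 n) : factorP I Δ (iotaP 𝕜 k f * p) = 0 := by
  rcases le_or_gt Δ k with hk | hk
  · refine factorP_mul_eq_zero_of_le I hk (iotaP_mem_supported k f) (toS_iotaP_of_mem I hfI k)
      (fun p => ?_) p
    rw [factorP_iotaP_mul I hf, toA_eq_zero I hfI, zero_smul]
  rcases Nat.eq_zero_or_pos d with rfl | hd
  · obtain ⟨c, rfl⟩ := exists_eq_algebraMap_of_mem_pieceF_zero hf
    -- A constant has the same image for every starting place, so the case `k = Δ` suffices.
    have h1 : ∀ k, iotaP 𝕜 k (algebraMap 𝕜 (F 𝕜 n) c) = c • 1 := fun k => by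
      rw [Algebra.algebraMap_eq_smul_one, map_smul, ← word_nil 𝕜, iotaP_word,
        wordMonomialFrom_nil]
    have := factorP_iotaP_mul I (Δ := Δ) hf p
    rw [toA_eq_zero I hfI, zero_smul, h1] at this
    rw [h1, this]
  · refine pieceF_induction hf (fun w hw => ?_) ?_ (fun f g hf hg => ?_) (fun c f hf => ?_)
    · cases w with
      | nil => exact absurd hw hd.ne
      | cons i w => rw [iotaP_word, wordMonomialFrom_cons, mul_assoc, factorP_X_mul_of_lt I hk]
    · simp
    · rw [map_add, add_mul, map_add, hf, hg, add_zero]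
    · rw [map_smul, smul_mul_assoc, map_smul, hf, smul_zero]

/-- At `Δ = j` the first variable raises the starting place to `j + 1`, where the second one is
forbidden. -/
theorem factorP_X_mul_X_mul (Δ : ℕ) (i k : Fin n) (j : ℕ) (p : P 𝕜 n) :
    factorP I Δ (MvPolynomial.X (i, j) * MvPolynomial.X (k, j) * p) = 0 := by
  rcases le_or_gt Δ j with hj | hj
  · refine factorP_mul_eq_zero_of_le I hj (mul_mem (MvPolynomial.X_mem_supported.2 (le_refl j))
      (MvPolynomial.X_mem_supported.2 (le_refl j))) (toS_X_mul_X I i k j) (fun p => ?_) p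
    rw [mul_assoc, factorP_X_mul, factorP_X_mul_of_lt I (Nat.lt_succ_self j), smul_zero]
  · rw [mul_assoc, factorP_X_mul_of_lt I hj]

/-- Over a field the surjection has a linear section. `ψ` composed with it is the desired map. -/
theorem exists_comp_eq_of_surjective {𝕜 U V W : Type*} [Field 𝕜] [AddCommGroup U]
    [AddCommGroup V] [AddCommGroup W] [Module 𝕜 U] [Module 𝕜 V] [Module 𝕜 W] {q : U →ₗ[𝕜] V}
    (hq : Function.Surjective q) {ψ : U →ₗ[𝕜] W} (h : ∀ u, q u = 0 → ψ u = 0) :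
    ∃ ψ' : V →ₗ[𝕜] W, ∀ u, ψ' (q u) = ψ u := by
  obtain ⟨g, hg⟩ := q.exists_rightInverse_of_surjective (LinearMap.range_eq_top.2 hq)
  refine ⟨ψ ∘ₗ g, fun u => ?_⟩
  rw [LinearMap.comp_apply, ← sub_eq_zero, ← map_sub]
  refine h _ ?_
  rw [map_sub, sub_eq_zero]
  exact LinearMap.congr_fun hg (q u)

theorem exists_factor (hI : IsGraded I) (Δ : ℕ) :
    ∃ ψ : S I →ₗ[𝕜] A I ⊗[𝕜] S I, ∀ p, ψ (toS I p) = factorP I Δ p := by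
  exact exists_comp_eq_of_surjective (q := (toS I).toLinearMap) (toS_surjective I)
    fun p hp => eq_zero_of_toS_eq_zero I _ hI (factorP_X_mul_X_mul I Δ)
      (fun d k f hfI hf => factorP_iotaP_mul_of_mem I hfI hf Δ k) hp

theorem toS_iotaP (k : ℕ) (f : F 𝕜 n) :
    toS I (iotaP 𝕜 k f) = (sigma I)^[k] (iota I (toA I f)) := by
  have h0 : iota I (toA I f) = Ideal.Quotient.mkₐ 𝕜 (J I) (iotaF 𝕜 n f) := rfl
  rw [h0, toS, AlgHom.comp_apply, ← sigmaR_iterate_iotaF]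
  generalize iotaF 𝕜 n f = r
  induction k with
  | zero => rfl
  | succ k ih =>
    rw [Function.iterate_succ_apply', Function.iterate_succ_apply', ← ih]
    rfl

/-- The map `σ^k ∘ ι : A → S` as a linear map. -/
noncomputable def sigmaIota (k : ℕ) : A I →ₗ[𝕜] S I :=
  ((sigma I).toLinearMap ^ k) ∘ₗ iota I

theorem sigmaIota_apply (k : ℕ) (a : A I) : sigmaIota I k a = (sigma I)^[k] (iota I a) := by
  rw [sigmaIota, LinearMap.comp_apply, Module.End.pow_apply]
  rfl

theorem sigmaIota_toA (k : ℕ) (f : F 𝕜 n) : sigmaIota I k (toA I f) = toS I (iotaP 𝕜 k f) := by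
  rw [sigmaIota_apply, toS_iotaP]

theorem toA_mem_pieceA {d : ℕ} {f : F 𝕜 n} (hf : f ∈ pieceF 𝕜 n d) : toA I f ∈ pieceA I d :=
  ⟨f, hf, rfl⟩

theorem exists_of_mem_pieceA {d : ℕ} {a : A I} (ha : a ∈ pieceA I d) :
    ∃ f ∈ pieceF 𝕜 n d, toA I f = a := ha

theorem sigmaIota_mul {t : ℕ} {a : A I} (ha : a ∈ pieceA I t) (k : ℕ) (b : A I) :
    sigmaIota I k (a * b) = sigmaIota I k a * sigmaIota I (k + t) b := by
  obtain ⟨f, hf, rfl⟩ := exists_of_mem_pieceA I ha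
  obtain ⟨b, rfl⟩ := toA_surjective I b
  rw [← map_mul, sigmaIota_toA, iotaP_mul hf, map_mul, sigmaIota_toA, sigmaIota_toA]

theorem sigmaIota_one (k : ℕ) : sigmaIota I k 1 = 1 := by
  rw [← map_one (toA I), sigmaIota_toA, ← word_nil 𝕜, iotaP_word, wordMonomialFrom_nil, map_one]

/-- Each word in `a` already occupies place `l`, and two variables in one place multiply to zero. -/
theorem x_mul_sigmaIota {t : ℕ} {a : A I} (ha : a ∈ pieceA I t) {k l : ℕ} (hkl : k ≤ l)
    (hl : l < k + t) (i : Fin n) : x I i l * sigmaIota I k a = 0 := by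
  obtain ⟨f, hf, rfl⟩ := exists_of_mem_pieceA I ha
  rw [sigmaIota_toA]
  refine pieceF_induction hf (fun w hw => ?_) ?_ (fun f g hf hg => ?_) (fun c f hf => ?_)
  · rw [iotaP_word]
    subst hw
    clear hf ha
    induction w generalizing k with
    | nil => simp at hl; omega
    | cons j w ih =>
      rw [wordMonomialFrom_cons, map_mul, toS_X]
      rcases hkl.eq_or_lt with rfl | hlt
      · rw [← mul_assoc, x_mul_x, zero_mul]
      · rw [mul_left_comm, ih hlt (by rw [List.length_cons] at hl; omega), mul_zero]
  · simp
  · rw [map_add, map_add, mul_add, hf, hg, add_zero]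
  · rw [map_smul, map_smul, mul_smul_comm, hf, smul_zero]

/-- The multiplication `a ⊗ y ↦ σ^Δ(ι(a)) y`. -/
noncomputable def recombine (Δ : ℕ) : A I ⊗[𝕜] S I →ₗ[𝕜] S I :=
  TensorProduct.lift (LinearMap.mul 𝕜 (S I) ∘ₗ sigmaIota I Δ)

@[simp] theorem recombine_tmul (Δ : ℕ) (a : A I) (y : S I) :
    recombine I Δ (a ⊗ₜ y) = sigmaIota I Δ a * y := rfl

theorem recombine_smul {t : ℕ} {a : A I} (ha : a ∈ pieceA I t) (Δ : ℕ) (z : A I ⊗[𝕜] S I) :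
    recombine I Δ (a • z) = sigmaIota I Δ a * recombine I (Δ + t) z := by
  induction z using TensorProduct.induction_on with
  | zero => simp
  | tmul b y =>
    rw [TensorProduct.smul_tmul', recombine_tmul, recombine_tmul, smul_eq_mul,
      sigmaIota_mul I ha, mul_assoc]
  | add y z hy hz => rw [smul_add, map_add, hy, hz, map_add, mul_add]

/-- The ideal of `S` generated by the variables in the first `Δ` places. -/
noncomputable def initialIdeal (Δ : ℕ) : Ideal (S I) :=
  Ideal.span {y | ∃ (k : Fin n) (l : ℕ), l < Δ ∧ y = x I k l}

/-- The extra generators, in place `Δ`, are annihilated by `x_{iΔ}`. -/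
theorem x_mul_mem_initialIdeal {Δ : ℕ} (i : Fin n) {y : S I} (hy : y ∈ initialIdeal I (Δ + 1)) :
    x I i Δ * y ∈ initialIdeal I Δ := by
  induction hy using Submodule.span_induction with
  | mem y hy =>
    obtain ⟨k, l, hl, rfl⟩ := hy
    rcases (Nat.lt_succ_iff.1 hl).eq_or_lt with rfl | hlt
    · rw [x_mul_x]; exact zero_mem _
    · exact Ideal.mul_mem_left _ _ (Ideal.subset_span ⟨k, l, hlt, rfl⟩)
  | zero => rw [mul_zero]; exact zero_mem _
  | add y z _ _ hy hz => rw [mul_add]; exact add_mem hy hz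
  | smul c y _ hy => rw [smul_eq_mul, mul_left_comm]; exact Ideal.mul_mem_left _ _ hy

theorem toA_ι_mem_pieceA (i : Fin n) : toA I (FreeAlgebra.ι 𝕜 i) ∈ pieceA I 1 := by
  have := toA_mem_pieceA I (word_mem_pieceF 𝕜 [i])
  rwa [word_cons, word_nil, mul_one] at this

theorem sigmaIota_ι (k : ℕ) (i : Fin n) : sigmaIota I k (toA I (FreeAlgebra.ι 𝕜 i)) = x I i k := by
  have := sigmaIota_toA I k (word 𝕜 [i])
  rw [iotaP_word, word_cons, word_nil, mul_one, wordMonomialFrom_cons, wordMonomialFrom_nil,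
    mul_one, toS_X] at this
  exact this

/-- Induction on the degree of a monomial: one with places only beyond `Δ` is recovered exactly, one
with an earlier place is in the ideal, and a variable in place `Δ` can be stripped off. -/
theorem sub_recombine_factorP_mem (Δ : ℕ) (p : P 𝕜 n) :
    toS I p - recombine I Δ (factorP I Δ p) ∈ initialIdeal I Δ := by
  induction p using monomial_induction with
  | monomial e =>
    obtain ⟨N, hN⟩ : ∃ N, e.degree = N := ⟨_, rfl⟩
    induction N generalizing Δ e with
    | zero =>
      obtain rfl : e = 0 := (Finsupp.degree_eq_zero_iff e).1 hN
      rw [factorP_of_mem_supported I (monomial_mem_supported fun q hq => absurd rfl hq),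
        recombine_tmul, sigmaIota_one, one_mul, sub_self]
      exact zero_mem _
    | succ N ih =>
      by_cases he : ∀ q, e q ≠ 0 → Δ < q.2
      · rw [factorP_of_mem_supported I (monomial_mem_supported he),
          recombine_tmul, sigmaIota_one, one_mul, sub_self]
        exact zero_mem _
      · push Not at he
        obtain ⟨⟨i, j⟩, hq, hj⟩ := he
        obtain ⟨e₀, h₀, h₁⟩ := exists_eq_X_mul_of_ne_zero (𝕜 := 𝕜) hq
        rw [h₀]
        rcases (show j ≤ Δ from hj).lt_or_eq with hlt | rfl
        · rw [factorP_X_mul_of_lt I hlt i, map_zero, sub_zero, map_mul, toS_X]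
          exact Ideal.mul_mem_right _ _ (Ideal.subset_span ⟨i, j, hlt, rfl⟩)
        · rw [factorP_X_mul, recombine_smul I (toA_ι_mem_pieceA I i), sigmaIota_ι, map_mul, toS_X,
            ← mul_sub]
          refine x_mul_mem_initialIdeal I i (ih (j + 1) e₀ ?_)
          rw [h₁, map_add, Finsupp.degree_single] at hN
          omega
  | add f g hf hg =>
    rw [map_add, map_add, map_add, add_sub_add_comm]
    exact add_mem hf hg
  | smul c f hf =>
    rw [map_smul, map_smul, map_smul, ← smul_sub]
    exact Submodule.smul_of_tower_mem _ c hf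

/-- Evaluation of all variables at zero kills the relations of `S`, so `1` is nonzero there; any
functional normalized at `1` serves. -/
theorem exists_augmentation (hI : IsGraded I) (hI1 : (1 : F 𝕜 n) ∉ I) :
    ∃ ε : S I →ₗ[𝕜] 𝕜, ε 1 = 1 := by
  have : (1 : S I) ≠ 0 := by
    intro h1
    refine one_ne_zero (α := 𝕜) ?_
    have := eq_zero_of_toS_eq_zero I (MvPolynomial.aeval (R := 𝕜) (S₁ := 𝕜)
      (fun _ : Fin n × ℕ => 0)).toLinearMap hI (fun i k j p => by simp)
      (fun d k f hfI hf p => ?_) (p := 1) (by rw [map_one, h1])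
    · simp at this
    · rw [AlgHom.toLinearMap_apply, map_mul]
      rcases Nat.eq_zero_or_pos d with rfl | hd
      · obtain ⟨c, rfl⟩ := exists_eq_algebraMap_of_mem_pieceF_zero hf
        -- A nonzero constant in `I` would put `1` into `I`.
        have hc : c = 0 := by
          by_contra hc
          refine hI1 ?_
          have := I.mul_mem_left (algebraMap 𝕜 _ c⁻¹) hfI
          rwa [← map_mul, inv_mul_cancel₀ hc, map_one] at this
        rw [hc, map_zero, map_zero, map_zero, zero_mul]
      · refine pieceF_induction hf (fun w hw => ?_) ?_ (fun f g hf hg => ?_) (fun c f hf => ?_)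
        · cases w with
          | nil => exact absurd hw hd.ne
          | cons i w => rw [iotaP_word, wordMonomialFrom_cons]; simp
        · simp
        · rw [map_add, map_add, add_mul, hf, hg, add_zero]
        · rw [map_smul, map_smul, smul_mul_assoc, hf, smul_zero]
  exact Module.Projective.exists_dual_eq_one 𝕜 this

end Factorization

/-! ### The factorization map on `S` and its properties. -/

section FactorS

attribute [local instance] S.commRing

variable {𝕜 : Type*} [Field 𝕜] {n : ℕ} {I : Ideal (F 𝕜 n)} [I.IsTwoSided]

/-- The factorization map on `S`: the product of `σ^Δ(ι(u))`, for a word `u`, with a monomial in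
the places beyond `Δ + |u| + 1` is sent to the tensor product of the factors. -/
noncomputable def factor (hI : IsGraded I) (Δ : ℕ) : S I →ₗ[𝕜] A I ⊗[𝕜] S I :=
  (exists_factor I hI Δ).choose

theorem factor_toS (hI : IsGraded I) (Δ : ℕ) (p : P 𝕜 n) :
    factor hI Δ (toS I p) = factorP I Δ p :=
  (exists_factor I hI Δ).choose_spec p

theorem factor_x_mul (hI : IsGraded I) {Δ l : ℕ} (hl : l < Δ) (i : Fin n) (y : S I) :
    factor hI Δ (x I i l * y) = 0 := by
  obtain ⟨p, rfl⟩ := toS_surjective I y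
  rw [← toS_X, ← map_mul, factor_toS, factorP_X_mul_of_lt I hl]

theorem factor_sigmaIota_mul (hI : IsGraded I) {t : ℕ} {a : A I} (ha : a ∈ pieceA I t) (Δ : ℕ)
    (y : S I) : factor hI Δ (sigmaIota I Δ a * y) = a • factor hI (Δ + t) y := by
  obtain ⟨p, rfl⟩ := toS_surjective I y
  obtain ⟨f, hf, rfl⟩ := exists_of_mem_pieceA I ha
  rw [sigmaIota_toA, ← map_mul, factor_toS, factor_toS, factorP_iotaP_mul I hf]

theorem factor_one (hI : IsGraded I) (Δ : ℕ) : factor hI Δ 1 = 1 ⊗ₜ 1 := by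
  rw [← map_one (toS I), factor_toS, factorP_of_mem_supported I (one_mem _)]

theorem sub_recombine_factor_mem (hI : IsGraded I) (Δ : ℕ) (y : S I) :
    y - recombine I Δ (factor hI Δ y) ∈ initialIdeal I Δ := by
  obtain ⟨p, rfl⟩ := toS_surjective I y
  rw [factor_toS]
  exact sub_recombine_factorP_mem I Δ p

end FactorS

end Letterplace

namespace Letterplace

/-! ### Gradings of `A`, `S` and the shifted free modules. -/

section Gradings

attribute [local instance] S.commRing

variable {𝕜 : Type*} [Field 𝕜] {n : ℕ}

/-- The map `θ` records degrees by powers of a formal variable, so its coefficients are the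
projections onto the components. -/
theorem exists_isGradedSpace {B : Type*} [Ring B] [Algebra 𝕜 B] {𝓑 : ℕ → Submodule 𝕜 B}
    (θ : B →ₗ[𝕜] Polynomial B) (hθ : ∀ d, ∀ b ∈ 𝓑 d, θ b = Polynomial.monomial d b)
    (htop : ⨆ d, 𝓑 d = ⊤) : ∃ π, IsGradedSpace 𝓑 π := by
  refine ⟨fun d => (Polynomial.lcoeff B d).restrictScalars 𝕜 ∘ₗ θ, ?_, ?_, htop⟩
  · intro d b hb
    simp [hθ d b hb]
  · intro d e b hb hne
    simp [hθ e b hb, Polynomial.coeff_monomial, hne]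

theorem IsGradedSpace.pi {B : Type*} [AddCommGroup B] [Module 𝕜 B] {𝓑 : ℕ → Submodule 𝕜 B}
    {π : ℕ → B →ₗ[𝕜] B} (H : IsGradedSpace 𝓑 π) {m : ℕ} (δ : Fin m → ℕ) :
    IsGradedSpace (piece 𝓑 δ) fun d => LinearMap.pi fun j =>
      if δ j ≤ d then π (d - δ j) ∘ₗ LinearMap.proj j else 0 := by
  have hmem : ∀ {d v}, v ∈ piece 𝓑 δ d → ∀ j, v j ∈ if δ j ≤ d then 𝓑 (d - δ j) else ⊥ :=
    fun hv j => hv j trivial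
  refine ⟨?_, ?_, ?_⟩
  · intro d v hv
    ext j
    have := hmem hv j
    by_cases hj : δ j ≤ d
    · simp only [hj, if_true] at this
      simp [hj, H.proj_same this]
    · simp only [hj, if_false, Submodule.mem_bot] at this
      simp [hj, this]
  · intro d e v hv hne
    ext j
    have := hmem hv j
    by_cases hj : δ j ≤ e
    · simp only [hj, if_true] at this
      by_cases hd : δ j ≤ d
      · simp [hd, H.proj_ne this (show e - δ j ≠ d - δ j by omega)]
      · simp [hd]
    · simp only [hj, if_false, Submodule.mem_bot] at this
      by_cases hd : δ j ≤ d <;> simp [hd, this]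
  · rw [eq_top_iff]
    rintro v -
    rw [← Finset.univ_sum_single v]
    refine Submodule.sum_mem _ fun j _ => ?_
    have hv : v j ∈ ⨆ d, 𝓑 d := H.iSup_eq_top ▸ Submodule.mem_top
    refine Submodule.iSup_induction _ (motive := fun b => Pi.single j b ∈ ⨆ d, piece 𝓑 δ d) hv
      (fun i b hb => ?_) ?_ fun a b ha hb => ?_
    · refine Submodule.mem_iSup_of_mem (i + δ j) fun k _ => ?_
      rcases eq_or_ne k j with rfl | hne
      · simpa using hb
      · simp [Pi.single_eq_of_ne hne]
    · rw [Pi.single_zero]; exact zero_mem _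
    · rw [Pi.single_add]; exact add_mem ha hb

theorem mem_piece {B : Type*} [AddCommGroup B] [Module 𝕜 B] {𝓑 : ℕ → Submodule 𝕜 B}
    {m : ℕ} {δ : Fin m → ℕ} {d : ℕ} {v : Fin m → B} :
    v ∈ piece 𝓑 δ d ↔ ∀ j, (δ j ≤ d → v j ∈ 𝓑 (d - δ j)) ∧ (d < δ j → v j = 0) := by
  have : v ∈ piece 𝓑 δ d ↔ ∀ j, v j ∈ if δ j ≤ d then 𝓑 (d - δ j) else ⊥ := by
    simp [piece, Submodule.mem_pi]
  rw [this]
  refine forall_congr' fun j => ?_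
  by_cases hj : δ j ≤ d
  · simp [hj]
  · simp [hj, not_le.1 hj]

theorem wordMonomialFrom_isHomogeneous (k : ℕ) (w : List (Fin n)) :
    (wordMonomialFrom 𝕜 k w).IsHomogeneous w.length := by
  induction w generalizing k with
  | nil => exact MvPolynomial.isHomogeneous_one _ _
  | cons i w ih =>
    rw [wordMonomialFrom_cons, List.length_cons, add_comm w.length]
    have hX : (MvPolynomial.X (i, k) : P 𝕜 n).IsHomogeneous 1 := MvPolynomial.isHomogeneous_X _ _
    exact hX.mul (ih (k + 1))

theorem iotaP_isHomogeneous {d : ℕ} {f : F 𝕜 n} (hf : f ∈ pieceF 𝕜 n d) (k : ℕ) :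
    (iotaP 𝕜 k f).IsHomogeneous d := by
  change iotaP 𝕜 k f ∈ MvPolynomial.homogeneousSubmodule _ _ d
  refine pieceF_induction hf (fun w hw => ?_) ?_ (fun f g hf hg => ?_) (fun c f hf => ?_)
  · rw [iotaP_word, ← hw]; exact wordMonomialFrom_isHomogeneous k w
  · rw [map_zero]; exact zero_mem _
  · rw [map_add]; exact add_mem hf hg
  · rw [map_smul]; exact Submodule.smul_mem _ c hf

variable (I : Ideal (F 𝕜 n)) [I.IsTwoSided]

theorem iSup_pieceA : ⨆ d, pieceA I d = ⊤ := by
  rw [eq_top_iff]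
  rintro a -
  obtain ⟨f, rfl⟩ := toA_surjective I a
  have : f ∈ Submodule.span 𝕜 (Set.range (word 𝕜 (n := n))) :=
    span_range_word 𝕜 ▸ Submodule.mem_top
  induction this using Submodule.span_induction with
  | mem f hf =>
    obtain ⟨w, rfl⟩ := hf
    exact Submodule.mem_iSup_of_mem w.length (toA_mem_pieceA I (word_mem_pieceF 𝕜 w))
  | zero => rw [map_zero]; exact zero_mem _
  | add f g _ _ hf hg => rw [map_add]; exact add_mem hf hg
  | smul c f _ hf => rw [map_smul]; exact Submodule.smul_mem _ c hf

theorem exists_isGradedSpace_pieceA (hI : IsGraded I) : ∃ π, IsGradedSpace (pieceA I) π := by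
  -- Each generator is multiplied by the formal variable. Because `I` is graded, this map descends
  -- to `A`.
  let θ : F 𝕜 n →ₐ[𝕜] Polynomial (A I) :=
    FreeAlgebra.lift 𝕜 fun i => Polynomial.monomial 1 (toA I (FreeAlgebra.ι 𝕜 i))
  have hθ : ∀ d, ∀ f ∈ pieceF 𝕜 n d, θ f = Polynomial.monomial d (toA I f) := by
    intro d f hf
    refine pieceF_induction hf (fun w hw => ?_) ?_ (fun f g hf hg => ?_) (fun c f hf => ?_)
    · subst hw
      clear hf
      induction w with
      | nil => rw [word_nil, map_one, map_one]; rfl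
      | cons i w ih =>
        rw [word_cons, map_mul, ih, map_mul, FreeAlgebra.lift_ι_apply,
          Polynomial.monomial_mul_monomial, List.length_cons, add_comm]
    · simp
    · rw [map_add, hf, hg, map_add, map_add]
    · rw [map_smul, hf, map_smul, Polynomial.smul_monomial]
  have hker : ∀ f, toA I f = 0 → θ f = 0 := by
    intro f hf
    have hf' : f ∈ ⨆ d : ℕ, I.restrictScalars 𝕜 ⊓ pieceF 𝕜 n d :=
      hI ▸ (Ideal.Quotient.eq_zero_iff_mem.1 hf : f ∈ I)
    refine Submodule.iSup_induction _ (motive := fun f => θ f = 0) hf' (fun d f hf => ?_) ?_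
      fun f g hf hg => ?_
    · rw [hθ d f hf.2, toA_eq_zero I hf.1, map_zero]
    · rw [map_zero]
    · rw [map_add, hf, hg, add_zero]
  obtain ⟨ψ, hψ⟩ := exists_comp_eq_of_surjective (q := (toA I).toLinearMap)
    (ψ := θ.toLinearMap) (toA_surjective I) hker
  refine exists_isGradedSpace ψ (fun d a ha => ?_) (iSup_pieceA I)
  obtain ⟨f, hf, rfl⟩ := exists_of_mem_pieceA I ha
  exact (hψ f).trans (hθ d f hf)

theorem pieceA_zero {a : A I} (ha : a ∈ pieceA I 0) : ∃ c : 𝕜, a = algebraMap 𝕜 (A I) c := by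
  obtain ⟨f, hf, rfl⟩ := exists_of_mem_pieceA I ha
  obtain ⟨c, rfl⟩ := exists_eq_algebraMap_of_mem_pieceF_zero hf
  exact ⟨c, (toA I).commutes c⟩

theorem pieceF_mul_mem {i j : ℕ} {f g : F 𝕜 n} (hf : f ∈ pieceF 𝕜 n i) (hg : g ∈ pieceF 𝕜 n j) :
    f * g ∈ pieceF 𝕜 n (i + j) := by
  refine pieceF_induction hf (fun v hv => ?_) ?_ (fun f f' hf hf' => ?_) (fun c f hf => ?_)
  · refine pieceF_induction hg (fun w hw => ?_) ?_ (fun f g hf hg => ?_) (fun c f hf => ?_)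
    · rw [← word_append]
      convert word_mem_pieceF 𝕜 (v ++ w)
      rw [List.length_append, hv, hw]
    · rw [mul_zero]; exact zero_mem _
    · rw [mul_add]; exact add_mem hf hg
    · rw [mul_smul_comm]; exact Submodule.smul_mem _ c hf
  · rw [zero_mul]; exact zero_mem _
  · rw [add_mul]; exact add_mem hf hf'
  · rw [smul_mul_assoc]; exact Submodule.smul_mem _ c hf

theorem pieceA_mul_mem {i j : ℕ} {a b : A I} (ha : a ∈ pieceA I i) (hb : b ∈ pieceA I j) :
    a * b ∈ pieceA I (i + j) := by
  obtain ⟨f, hf, rfl⟩ := exists_of_mem_pieceA I ha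
  obtain ⟨g, hg, rfl⟩ := exists_of_mem_pieceA I hb
  rw [← map_mul]
  exact toA_mem_pieceA I (pieceF_mul_mem hf hg)

theorem pieceA_fg (d : ℕ) : (pieceA I d).FG := by
  refine Submodule.FG.map _ (Submodule.fg_span ?_)
  refine ((List.finite_length_eq (Fin n) d).image fun w => word 𝕜 w).subset ?_
  rintro _ ⟨w, hw, rfl⟩
  exact ⟨w, hw, rfl⟩

theorem piece_fg {B : Type*} [AddCommGroup B] [Module 𝕜 B] {𝓑 : ℕ → Submodule 𝕜 B}
    (h : ∀ d, (𝓑 d).FG) {m : ℕ} (δ : Fin m → ℕ) (d : ℕ) : (piece 𝓑 δ d).FG := by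
  refine Submodule.fg_pi fun j => ?_
  split_ifs
  · exact h _
  · exact Submodule.fg_bot

theorem isGradedAction_pieceA {π : ℕ → A I →ₗ[𝕜] A I} (H : IsGradedSpace (pieceA I) π) {m : ℕ}
    (δ : Fin m → ℕ) :
    IsGradedAction (T := (A I)ᵐᵒᵖ)
      (fun d => (pieceA I d).map (MulOpposite.opLinearEquiv 𝕜).toLinearMap)
      (piece (pieceA I) δ) (fun d => LinearMap.pi fun j =>
        if δ j ≤ d then π (d - δ j) ∘ₗ LinearMap.proj j else 0) where
  toIsGradedSpace := H.pi δ
  connected := by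
    rintro _ ⟨a, ha, rfl⟩
    obtain ⟨c, rfl⟩ := pieceA_zero I ha
    exact ⟨c, rfl⟩
  scalars_iSup := by
    rw [← Submodule.map_iSup, iSup_pieceA, Submodule.map_top]
    exact LinearEquiv.range _
  mul_mem := by
    rintro i j _ _ ⟨a, ha, rfl⟩ ⟨b, hb, rfl⟩
    exact ⟨b * a, add_comm j i ▸ pieceA_mul_mem I hb ha, rfl⟩
  smul_mem := by
    rintro i d _ v ⟨a, ha, rfl⟩ hv
    rw [mem_piece] at hv ⊢
    intro j
    change (_ → v j * a ∈ _) ∧ (_ → v j * a = 0)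
    by_cases hj : δ j ≤ d
    · refine ⟨fun _ => ?_, fun _ => by omega⟩
      rw [show i + d - δ j = d - δ j + i by omega]
      exact pieceA_mul_mem I ((hv j).1 hj) ha
    · rw [(hv j).2 (not_le.1 hj), zero_mul]
      exact ⟨fun _ => zero_mem _, fun _ => rfl⟩

theorem toS_mem_pieceS {d : ℕ} {p : P 𝕜 n} (hp : p.IsHomogeneous d) : toS I p ∈ pieceS I d :=
  ⟨_, ⟨p, hp, rfl⟩, rfl⟩

theorem exists_of_mem_pieceS {d : ℕ} {y : S I} (hy : y ∈ pieceS I d) :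
    ∃ p : P 𝕜 n, p.IsHomogeneous d ∧ toS I p = y := by
  obtain ⟨_, ⟨p, hp, rfl⟩, rfl⟩ := hy
  exact ⟨p, hp, rfl⟩

theorem iSup_pieceS : ⨆ d, pieceS I d = ⊤ := by
  rw [eq_top_iff]
  rintro y -
  obtain ⟨p, rfl⟩ := toS_surjective I y
  induction p using monomial_induction with
  | monomial e =>
    exact Submodule.mem_iSup_of_mem e.degree
      (toS_mem_pieceS I (MvPolynomial.isHomogeneous_monomial 1 rfl))
  | add f g hf hg => rw [map_add]; exact add_mem hf hg
  | smul c f hf => rw [map_smul]; exact Submodule.smul_mem _ c hf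

theorem exists_isGradedSpace_pieceS (hI : IsGraded I) : ∃ π, IsGradedSpace (pieceS I) π := by
  let θ : P 𝕜 n →ₐ[𝕜] Polynomial (S I) :=
    MvPolynomial.aeval fun q => Polynomial.monomial 1 (x I q.1 q.2)
  have hX : ∀ q, θ (MvPolynomial.X q) = Polynomial.monomial 1 (x I q.1 q.2) :=
    fun q => MvPolynomial.aeval_X _ q
  have hmon : ∀ e, θ (MvPolynomial.monomial e 1) =
      Polynomial.monomial e.degree (toS I (MvPolynomial.monomial e 1)) := by
    intro e
    induction e using Finsupp.induction_linear with
    | zero =>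
      rw [show (MvPolynomial.monomial 0 1 : P 𝕜 n) = 1 from rfl, map_one, map_one, map_zero]
      rfl
    | add e e' he he' =>
      rw [show (MvPolynomial.monomial (e + e') 1 : P 𝕜 n) = MvPolynomial.monomial e 1 *
        MvPolynomial.monomial e' 1 by rw [MvPolynomial.monomial_mul, mul_one], map_mul, he, he',
        map_mul, Polynomial.monomial_mul_monomial, map_add]
    | single q k =>
      rw [← MvPolynomial.X_pow_eq_monomial, map_pow, hX, map_pow, Polynomial.monomial_pow,
        Finsupp.degree_single, one_mul]
      rfl
  have hθ : ∀ d, ∀ p : P 𝕜 n, p.IsHomogeneous d → θ p = Polynomial.monomial d (toS I p) := by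
    intro d p hp
    suffices h : ∀ e ∈ p.support, θ (MvPolynomial.monomial e (p.coeff e)) =
        Polynomial.monomial d (toS I (MvPolynomial.monomial e (p.coeff e))) by
      conv_lhs => rw [p.as_sum]
      conv_rhs => rw [p.as_sum]
      rw [map_sum, map_sum, map_sum]
      exact Finset.sum_congr rfl h
    intro e he
    have hd : e.degree = d := by
      rw [Finsupp.degree_eq_weight_one]
      exact hp (MvPolynomial.mem_support_iff.1 he)
    rw [← mul_one (p.coeff e), ← smul_eq_mul, ← MvPolynomial.smul_monomial, map_smul, map_smul,
      hmon, hd, Polynomial.smul_monomial]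
  have hker : ∀ p, toS I p = 0 → θ p = 0 := by
    intro p hp
    refine eq_zero_of_toS_eq_zero I θ.toLinearMap hI ?_ ?_ hp
    · intro i k j p
      rw [AlgHom.toLinearMap_apply, map_mul, map_mul, hX, hX, Polynomial.monomial_mul_monomial,
        x_mul_x, map_zero, zero_mul]
    · intro d k f hfI hf p
      rw [AlgHom.toLinearMap_apply, map_mul, hθ d _ (iotaP_isHomogeneous hf k),
        toS_iotaP_of_mem I hfI, map_zero, zero_mul]
  obtain ⟨ψ, hψ⟩ := exists_comp_eq_of_surjective (q := (toS I).toLinearMap)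
    (ψ := θ.toLinearMap) (toS_surjective I) hker
  refine exists_isGradedSpace ψ (fun d y hy => ?_) (iSup_pieceS I)
  obtain ⟨p, hp, rfl⟩ := exists_of_mem_pieceS I hy
  exact (hψ p).trans (hθ d p hp)

theorem pieceS_mul_mem {i j : ℕ} {a b : S I} (ha : a ∈ pieceS I i) (hb : b ∈ pieceS I j) :
    a * b ∈ pieceS I (i + j) := by
  obtain ⟨f, hf, rfl⟩ := exists_of_mem_pieceS I ha
  obtain ⟨g, hg, rfl⟩ := exists_of_mem_pieceS I hb
  rw [← map_mul]
  exact toS_mem_pieceS I (hf.mul hg)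

theorem isGradedAction_pieceS {π : ℕ → S I →ₗ[𝕜] S I} (H : IsGradedSpace (pieceS I) π) {m : ℕ}
    (δ : Fin m → ℕ) :
    IsGradedAction (pieceS I) (piece (pieceS I) δ) (fun d => LinearMap.pi fun j =>
        if δ j ≤ d then π (d - δ j) ∘ₗ LinearMap.proj j else 0) where
  toIsGradedSpace := H.pi δ
  connected := by
    intro t ht
    obtain ⟨p, hp, rfl⟩ := exists_of_mem_pieceS I ht
    rw [← MvPolynomial.totalDegree_zero_iff_isHomogeneous,
      MvPolynomial.totalDegree_eq_zero_iff_eq_C] at hp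
    rw [hp]
    exact ⟨_, (toS I).commutes _⟩
  scalars_iSup := iSup_pieceS I
  mul_mem := pieceS_mul_mem I
  smul_mem := by
    intro i d t v ht hv
    rw [mem_piece] at hv ⊢
    intro j
    change (_ → t * v j ∈ _) ∧ (_ → t * v j = 0)
    by_cases hj : δ j ≤ d
    · refine ⟨fun _ => ?_, fun _ => by omega⟩
      rw [show i + d - δ j = i + (d - δ j) by omega]
      exact pieceS_mul_mem I ht ((hv j).1 hj)
    · rw [(hv j).2 (not_le.1 hj), mul_zero]
      exact ⟨fun _ => zero_mem _, fun _ => rfl⟩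

theorem x_mem_pieceS (i : Fin n) (j : ℕ) : x I i j ∈ pieceS I 1 := by
  rw [← toS_X]
  exact toS_mem_pieceS I (MvPolynomial.isHomogeneous_X _ _)

theorem sigmaIota_mem_pieceS {d : ℕ} {a : A I} (ha : a ∈ pieceA I d) (k : ℕ) :
    sigmaIota I k a ∈ pieceS I d := by
  obtain ⟨f, hf, rfl⟩ := exists_of_mem_pieceA I ha
  rw [sigmaIota_toA]
  exact toS_mem_pieceS I (iotaP_isHomogeneous hf k)

end Gradings

end Letterplace

namespace Letterplace

open scoped TensorProduct

/-! ### The letterplace embedding of free modules, normal forms modulo `C`, and the retraction. -/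

section ModuleIota

attribute [local instance] S.commRing

variable {𝕜 : Type*} [Field 𝕜] {n : ℕ}

/-- This is what makes the kernels of `φ` and `L(φ)` graded. -/
theorem IsGradedSpace.map_proj {V W : Type*} [AddCommGroup V] [Module 𝕜 V] [AddCommGroup W]
    [Module 𝕜 W] {𝓥 : ℕ → Submodule 𝕜 V} {π : ℕ → V →ₗ[𝕜] V} {𝓦 : ℕ → Submodule 𝕜 W}
    {ρ : ℕ → W →ₗ[𝕜] W} (H : IsGradedSpace 𝓥 π) (H' : IsGradedSpace 𝓦 ρ) (L : V →ₗ[𝕜] W)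
    (hL : ∀ d, ∀ v ∈ 𝓥 d, L v ∈ 𝓦 d) (d : ℕ) (v : V) : L (π d v) = ρ d (L v) := by
  have hv : v ∈ ⨆ d, 𝓥 d := H.iSup_eq_top ▸ Submodule.mem_top
  refine Submodule.iSup_induction _ (motive := fun v => L (π d v) = ρ d (L v)) hv
    (fun e v hv => ?_) ?_ fun v w hv hw => ?_
  · by_cases hd : e = d
    · subst hd
      rw [H.proj_same hv, H'.proj_same (hL _ v hv)]
    · rw [H.proj_ne hv hd, H'.proj_ne (hL _ v hv) hd, map_zero]
  · simp only [map_zero]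
  · rw [map_add, map_add, hv, hw, map_add, map_add]

variable {I : Ideal (F 𝕜 n)} [I.IsTwoSided]

theorem moduleIota_apply {m : ℕ} (δ : Fin m → ℕ) (h : Fin m → A I) (j : Fin m) :
    moduleIota I δ h j = sigmaIota I (δ j) (h j) :=
  (sigmaIota_apply I _ _).symm

variable (I) in
/-- The module letterplace embedding as a linear map. -/
noncomputable def moduleIotaLinear {m : ℕ} (δ : Fin m → ℕ) :
    (Fin m → A I) →ₗ[𝕜] (Fin m → S I) :=
  LinearMap.pi fun j => sigmaIota I (δ j) ∘ₗ LinearMap.proj j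

theorem moduleIotaLinear_apply {m : ℕ} (δ : Fin m → ℕ) (h : Fin m → A I) :
    moduleIotaLinear I δ h = moduleIota I δ h :=
  funext fun j => (moduleIota_apply δ h j).symm

theorem moduleIota_mem_piece {m : ℕ} {δ : Fin m → ℕ} {d : ℕ} {h : Fin m → A I}
    (hh : h ∈ piece (pieceA I) δ d) : moduleIota I δ h ∈ piece (pieceS I) δ d := by
  rw [mem_piece] at hh ⊢
  intro j
  rw [moduleIota_apply]
  exact ⟨fun hj => sigmaIota_mem_pieceS I ((hh j).1 hj) _,
    fun hj => by rw [(hh j).2 hj, map_zero]⟩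

/-- On the coordinates of a homogeneous element, `σ^{δ_j} ι` is multiplicative. -/
theorem sigmaIota_mul_of_mem_piece {m : ℕ} {δ : Fin m → ℕ} {d : ℕ} {h : Fin m → A I}
    (hh : h ∈ piece (pieceA I) δ d) (j : Fin m) (a : A I) :
    sigmaIota I (δ j) (h j * a) = sigmaIota I (δ j) (h j) * sigmaIota I d a := by
  rw [mem_piece] at hh
  rcases le_or_gt (δ j) d with hj | hj
  · rw [sigmaIota_mul I ((hh j).1 hj), Nat.add_sub_cancel' hj]
  · rw [(hh j).2 hj, zero_mul, map_zero, zero_mul]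

/-- Since `δ_j + (d - δ_j) = d`, the image of `a` starts at the same place `d` in every coordinate,
so one scalar of `S` serves them all. -/
theorem moduleIota_smul {m : ℕ} {δ : Fin m → ℕ} {d : ℕ} {h : Fin m → A I}
    (hh : h ∈ piece (pieceA I) δ d) (a : A I) :
    moduleIota I δ (MulOpposite.op a • h) = sigmaIota I d a • moduleIota I δ h := by
  ext j
  rw [moduleIota_apply, Pi.smul_apply, Pi.smul_apply, moduleIota_apply, smul_eq_mul, mul_comm]
  exact sigmaIota_mul_of_mem_piece hh j a

theorem span_image_moduleIota (hI : IsGraded I) {m : ℕ} (δ : Fin m → ℕ)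
    {N : Submodule (A I)ᵐᵒᵖ (Fin m → A I)} {B : Set (Fin m → A I)}
    (hB : ∀ b ∈ B, ∃ d, b ∈ piece (pieceA I) δ d) (hN : Submodule.span (A I)ᵐᵒᵖ B = N) :
    Submodule.span (S I) (moduleIota I δ '' B) = analogue I δ N := by
  apply le_antisymm
  · exact Submodule.span_mono (Set.image_mono (hN ▸ Submodule.subset_span))
  · refine Submodule.span_le.2 ?_
    rintro _ ⟨h, hh, rfl⟩
    obtain ⟨π, hπ⟩ := exists_isGradedSpace_pieceA I hI
    have := (isGradedAction_pieceA I hπ δ).mem_span_homogeneous_smul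
      (hN.symm ▸ hh : h ∈ Submodule.span _ B)
    clear hh
    rw [← moduleIotaLinear_apply]
    induction this using Submodule.span_induction with
    | mem w hw =>
      obtain ⟨i, _, b, ⟨a, ha, rfl⟩, hb, rfl⟩ := hw
      obtain ⟨d, hd⟩ := hB b hb
      rw [moduleIotaLinear_apply]
      exact moduleIota_smul hd a ▸ Submodule.smul_mem _ _ (Submodule.subset_span ⟨b, hb, rfl⟩)
    | zero => rw [map_zero]; exact zero_mem _
    | add v w _ _ hv hw => rw [map_add]; exact add_mem hv hw
    | smul c v _ hv => rw [map_smul]; exact Submodule.smul_of_tower_mem _ c hv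

theorem mem_C_iff {s : ℕ} {Δ : Fin s → ℕ} {v : Fin s → S I} :
    v ∈ C I Δ ↔ ∀ j, v j ∈ initialIdeal I (Δ j) := by
  constructor
  · intro hv j
    induction hv using Submodule.span_induction with
    | mem v hv =>
      obtain ⟨i, k, l, hl, rfl⟩ := hv
      rcases eq_or_ne j i with rfl | hne
      · rw [Pi.single_eq_same]
        exact Ideal.subset_span ⟨k, l, hl, rfl⟩
      · rw [Pi.single_eq_of_ne hne]
        exact zero_mem _
    | zero => exact zero_mem _
    | add v w _ _ hv hw => exact add_mem hv hw
    | smul c v _ hv => exact Ideal.mul_mem_left _ c hv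
  · intro hv
    rw [← Finset.univ_sum_single v]
    refine Submodule.sum_mem _ fun j _ => ?_
    have := hv j
    generalize v j = y at this
    induction this using Submodule.span_induction with
    | mem y hy =>
      obtain ⟨k, l, hl, rfl⟩ := hy
      exact Submodule.subset_span ⟨j, k, l, hl, rfl⟩
    | zero => rw [Pi.single_zero]; exact zero_mem _
    | add v w _ _ hv hw => rw [Pi.single_add]; exact add_mem hv hw
    | smul c v _ hv => rw [Pi.single_smul]; exact Submodule.smul_mem _ c hv

theorem factor_eq_zero_of_mem (hI : IsGraded I) {Δ : ℕ} {y : S I} (hy : y ∈ initialIdeal I Δ) :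
    factor hI Δ y = 0 := by
  suffices h : ∀ z, factor hI Δ (y * z) = 0 by
    have := h 1
    rwa [mul_one] at this
  induction hy using Submodule.span_induction with
  | mem y hy =>
    obtain ⟨k, l, hl, rfl⟩ := hy
    exact factor_x_mul hI hl k
  | zero => intro z; rw [zero_mul, map_zero]
  | add y y' _ _ hy hy' => intro z; rw [add_mul, map_add, hy, hy', add_zero]
  | smul c y _ hy => intro z; rw [smul_eq_mul, mul_assoc, mul_left_comm, hy]

/-- Modulo `C`, every vector is congruent to its normal form. -/
noncomputable def normalForm (hI : IsGraded I) {s : ℕ} (Δ : Fin s → ℕ) :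
    (Fin s → S I) →ₗ[𝕜] (Fin s → S I) :=
  LinearMap.pi fun j => recombine I (Δ j) ∘ₗ factor hI (Δ j) ∘ₗ LinearMap.proj j

theorem normalForm_apply (hI : IsGraded I) {s : ℕ} (Δ : Fin s → ℕ) (v : Fin s → S I)
    (j : Fin s) : normalForm hI Δ v j = recombine I (Δ j) (factor hI (Δ j) (v j)) := rfl

theorem sub_normalForm_mem (hI : IsGraded I) {s : ℕ} (Δ : Fin s → ℕ) (v : Fin s → S I) :
    v - normalForm hI Δ v ∈ C I Δ :=
  mem_C_iff.2 fun j => sub_recombine_factor_mem hI (Δ j) (v j)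

theorem normalForm_eq_zero (hI : IsGraded I) {s : ℕ} {Δ : Fin s → ℕ} {v : Fin s → S I}
    (hv : v ∈ C I Δ) : normalForm hI Δ v = 0 := by
  ext j
  rw [normalForm_apply, factor_eq_zero_of_mem hI (mem_C_iff.1 hv j), map_zero, Pi.zero_apply]

section Retraction

/-- The linear map `A ⊗ S → A` induced by a linear functional on `S`. -/
noncomputable def contract (ε : S I →ₗ[𝕜] 𝕜) : A I ⊗[𝕜] S I →ₗ[𝕜] A I :=
  TensorProduct.lift ((LinearMap.lsmul 𝕜 (A I)).flip.compl₂ ε)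

theorem contract_tmul (ε : S I →ₗ[𝕜] 𝕜) (a : A I) (y : S I) :
    contract ε (a ⊗ₜ y) = ε y • a := rfl

theorem contract_smul (ε : S I →ₗ[𝕜] 𝕜) (a : A I) (z : A I ⊗[𝕜] S I) :
    contract ε (a • z) = a * contract ε z := by
  induction z using TensorProduct.induction_on with
  | zero => rw [smul_zero, map_zero, mul_zero]
  | tmul b y => rw [TensorProduct.smul_tmul', contract_tmul, contract_tmul, smul_eq_mul,
      mul_smul_comm]
  | add y z hy hz => rw [smul_add, map_add, hy, hz, map_add, mul_add]

/-- A left inverse of the module letterplace embedding which vanishes on `C`. -/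
noncomputable def retraction (hI : IsGraded I) (ε : S I →ₗ[𝕜] 𝕜) {s : ℕ} (Δ : Fin s → ℕ) :
    (Fin s → S I) →ₗ[𝕜] (Fin s → A I) :=
  LinearMap.pi fun j => contract ε ∘ₗ factor hI (Δ j) ∘ₗ LinearMap.proj j

theorem retraction_apply (hI : IsGraded I) (ε : S I →ₗ[𝕜] 𝕜) {s : ℕ} (Δ : Fin s → ℕ)
    (v : Fin s → S I) (j : Fin s) :
    retraction hI ε Δ v j = contract ε (factor hI (Δ j) (v j)) := rfl

theorem retraction_eq_zero (hI : IsGraded I) (ε : S I →ₗ[𝕜] 𝕜) {s : ℕ} {Δ : Fin s → ℕ}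
    {v : Fin s → S I} (hv : v ∈ C I Δ) : retraction hI ε Δ v = 0 := by
  ext j
  rw [retraction_apply, factor_eq_zero_of_mem hI (mem_C_iff.1 hv j), map_zero, Pi.zero_apply]

theorem factor_sigmaIota_mul_of_mem_piece (hI : IsGraded I) {s : ℕ} {Δ : Fin s → ℕ} {d : ℕ}
    {h : Fin s → A I} (hh : h ∈ piece (pieceA I) Δ d) (j : Fin s) (y : S I) :
    factor hI (Δ j) (sigmaIota I (Δ j) (h j) * y) = h j • factor hI d y := by
  rw [mem_piece] at hh
  rcases le_or_gt (Δ j) d with hj | hj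
  · rw [factor_sigmaIota_mul hI ((hh j).1 hj), Nat.add_sub_cancel' hj]
  · rw [(hh j).2 hj, map_zero, zero_mul, map_zero, zero_smul]

/-- Homogeneity of `h` brings every coordinate to the same map `factor hI d`, so the outcome is a
single right multiple of `h`. -/
theorem retraction_smul_moduleIota (hI : IsGraded I) (ε : S I →ₗ[𝕜] 𝕜) {s : ℕ} {Δ : Fin s → ℕ}
    {d : ℕ} {h : Fin s → A I} (hh : h ∈ piece (pieceA I) Δ d) (y : S I) :
    retraction hI ε Δ (y • moduleIota I Δ h) =
      MulOpposite.op (contract ε (factor hI d y)) • h := by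
  ext j
  rw [retraction_apply, Pi.smul_apply, moduleIota_apply, smul_eq_mul, mul_comm,
    factor_sigmaIota_mul_of_mem_piece hI hh, contract_smul]
  rfl

theorem retraction_moduleIota (hI : IsGraded I) {ε : S I →ₗ[𝕜] 𝕜} (hε : ε 1 = 1) {s : ℕ}
    {Δ : Fin s → ℕ} {d : ℕ} {h : Fin s → A I} (hh : h ∈ piece (pieceA I) Δ d) :
    retraction hI ε Δ (moduleIota I Δ h) = h := by
  have := retraction_smul_moduleIota hI ε hh 1
  rwa [one_smul, factor_one, contract_tmul, hε, one_smul, MulOpposite.op_one, one_smul] at this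

theorem retraction_mem_span (hI : IsGraded I) (ε : S I →ₗ[𝕜] 𝕜) {s : ℕ} {Δ : Fin s → ℕ}
    {B : Set (Fin s → A I)} (hB : ∀ b ∈ B, ∃ d, b ∈ piece (pieceA I) Δ d) {v : Fin s → S I}
    (hv : v ∈ Submodule.span (S I) (moduleIota I Δ '' B)) :
    retraction hI ε Δ v ∈ Submodule.span (A I)ᵐᵒᵖ B := by
  -- The retraction is only `𝕜`-linear, so an arbitrary multiplier from `S` is built into the
  -- induction.
  suffices h : ∀ y : S I, retraction hI ε Δ (y • v) ∈ Submodule.span (A I)ᵐᵒᵖ B by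
    simpa using h 1
  induction hv using Submodule.span_induction with
  | mem v hv =>
    obtain ⟨b, hb, rfl⟩ := hv
    obtain ⟨d, hd⟩ := hB b hb
    intro y
    rw [retraction_smul_moduleIota hI ε hd]
    exact Submodule.smul_mem _ _ (Submodule.subset_span hb)
  | zero => intro y; rw [smul_zero, map_zero]; exact zero_mem _
  | add v w _ _ hv hw => intro y; rw [smul_add, map_add]; exact add_mem (hv y) (hw y)
  | smul c v _ hv => intro y; rw [smul_smul]; exact hv _

end Retraction

/-- The products of `σ^{Δ_j}(ι(b))`, for `b` of positive degree `d - Δ_j`, with the elements of the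
ideal generated by the first `d` places are decomposable in `C`. -/
theorem single_mem_decomposables {s : ℕ} {Δ : Fin s → ℕ} {j : Fin s} {d : ℕ} (hlt : Δ j < d)
    {b : A I} (hbd : b ∈ pieceA I (d - Δ j)) {z : S I} (hz : z ∈ initialIdeal I d) :
    Pi.single j (sigmaIota I (Δ j) b * z) ∈ decomposables (pieceS I) (C I Δ) := by
  suffices h : ∀ c, Pi.single j (sigmaIota I (Δ j) b * (c * z)) ∈
      decomposables (pieceS I) (C I Δ) by
    have := h 1
    rwa [one_mul] at this
  induction hz using Submodule.span_induction with
  | mem z hz =>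
    obtain ⟨k, l, hl, rfl⟩ := hz
    intro c
    -- Below `Δ_j` the variable gives a generator of `C`, multiplied by `b` of positive degree; from
    -- `Δ_j` up to `d - 1` its place is taken by `b` and the product vanishes.
    rcases lt_or_ge l (Δ j) with hlj | hlj
    · refine Submodule.subset_span ⟨d - Δ j, sigmaIota I (Δ j) b,
        c • Pi.single j (x I k l), by omega, sigmaIota_mem_pieceS I hbd _,
        Submodule.smul_mem _ c (Submodule.subset_span ⟨j, k, l, hlj, rfl⟩), ?_⟩
      rw [← Pi.single_smul, ← Pi.single_smul, smul_eq_mul, smul_eq_mul]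
    · rw [mul_left_comm, mul_comm _ (x I k l),
        x_mul_sigmaIota I hbd hlj (by omega), mul_zero, Pi.single_zero]
      exact zero_mem _
  | zero => intro c; rw [mul_zero, mul_zero, Pi.single_zero]; exact zero_mem _
  | add z z' _ _ hz hz' =>
    intro c
    rw [mul_add, mul_add, Pi.single_add]
    exact add_mem (hz c) (hz' c)
  | smul e z _ hz => intro c; rw [smul_eq_mul, ← mul_assoc c]; exact hz _

/-- If all coordinates of the homogeneous elements of `B` have positive degree, then the elements of
`C` generated by `ι(B)` are decomposable in `C`. -/
theorem mem_decomposables_of_mem_span (hI : IsGraded I) {s : ℕ} {Δ : Fin s → ℕ}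
    {B : Set (Fin s → A I)}
    (hB : ∀ b ∈ B, ∃ d, b ∈ piece (pieceA I) Δ d ∧ ∀ j, b j ≠ 0 → Δ j < d) {v : Fin s → S I}
    (hv : v ∈ Submodule.span (S I) (moduleIota I Δ '' B)) (hvC : v ∈ C I Δ) :
    v ∈ decomposables (pieceS I) (C I Δ) := by
  -- On `C` the normal form is zero, so it suffices to bound the defect `v - normalForm v`; the
  -- multiplier `y` compensates for the lack of `S`-linearity.
  suffices h : ∀ y : S I, y • v - normalForm hI Δ (y • v) ∈ decomposables (pieceS I) (C I Δ) by
    have := h 1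
    rwa [one_smul, normalForm_eq_zero hI hvC, sub_zero] at this
  clear hvC
  induction hv using Submodule.span_induction with
  | mem v hv =>
    obtain ⟨b, hb, rfl⟩ := hv
    obtain ⟨d, hd, hpos⟩ := hB b hb
    intro y
    rw [← Finset.univ_sum_single (y • moduleIota I Δ b - normalForm hI Δ (y • moduleIota I Δ b))]
    refine Submodule.sum_mem _ fun j _ => ?_
    by_cases hbj : b j = 0
    · have : (y • moduleIota I Δ b) j = 0 := by
        rw [Pi.smul_apply, moduleIota_apply, hbj, map_zero, smul_zero]
      rw [Pi.sub_apply, normalForm_apply, this, map_zero, map_zero, sub_zero, Pi.single_zero]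
      exact zero_mem _
    have hlt := hpos j hbj
    have hbd : b j ∈ pieceA I (d - Δ j) := ((mem_piece.1 hd) j).1 hlt.le
    have heq : (y • moduleIota I Δ b - normalForm hI Δ (y • moduleIota I Δ b)) j =
        sigmaIota I (Δ j) (b j) * (y - recombine I d (factor hI d y)) := by
      rw [Pi.sub_apply, normalForm_apply, Pi.smul_apply, moduleIota_apply, smul_eq_mul, mul_comm,
        factor_sigmaIota_mul_of_mem_piece hI hd, recombine_smul I hbd,
        Nat.add_sub_cancel' hlt.le, mul_sub]
    rw [heq]
    exact single_mem_decomposables hlt hbd (sub_recombine_factor_mem hI d y)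
  | zero => intro y; rw [smul_zero, map_zero, sub_zero]; exact zero_mem _
  | add v w _ _ hv hw =>
    intro y
    rw [smul_add, map_add, add_sub_add_comm]
    exact add_mem (hv y) (hw y)
  | smul c v _ hv => intro y; rw [smul_smul]; exact hv _

end ModuleIota

end Letterplace

namespace Letterplace

open scoped TensorProduct

/-! ### The kernel of `L(φ)` and its minimal bases. -/

section Kernels

attribute [local instance] S.commRing

variable {𝕜 : Type*} [Field 𝕜] {n : ℕ} {I : Ideal (F 𝕜 n)} [I.IsTwoSided]

/-- Expansion in the right tensor factor. Allowing every larger finite set lets one index set serve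
all coordinates of a vector simultaneously. -/
theorem exists_eq_sum_contract_tmul {κ : Type*} (b : Module.Basis κ 𝕜 (S I))
    (z : A I ⊗[𝕜] S I) :
    ∃ s₀ : Finset κ, ∀ s, s₀ ⊆ s → z = ∑ i ∈ s, contract (b.coord i) z ⊗ₜ b i := by
  classical
  induction z using TensorProduct.induction_on with
  | zero => exact ⟨∅, fun s _ => by simp only [map_zero, TensorProduct.zero_tmul,
      Finset.sum_const_zero]⟩
  | tmul a y =>
    refine ⟨(b.repr y).support, fun s hs => ?_⟩
    conv_lhs => rw [← b.linearCombination_repr y, Finsupp.linearCombination_apply,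
      Finsupp.sum_of_support_subset _ hs (fun i c => c • b i) (fun i _ => zero_smul _ _),
      TensorProduct.tmul_sum]
    refine Finset.sum_congr rfl fun i _ => ?_
    rw [contract_tmul, Module.Basis.coord_apply, TensorProduct.smul_tmul]
  | add y z hy hz =>
    obtain ⟨s, hs⟩ := hy
    obtain ⟨t, ht⟩ := hz
    refine ⟨s ∪ t, fun u hu => ?_⟩
    simp only [map_add, TensorProduct.add_tmul, Finset.sum_add_distrib]
    rw [← hs u (Finset.union_subset_left hu), ← ht u (Finset.union_subset_right hu)]

variable {r s : ℕ} {g : Fin s → Fin r → A I} {Δ : Fin s → ℕ}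

theorem phi_apply (f : Fin s → A I) (l : Fin r) : phi I g f l = ∑ j, g j l * f j := by
  change (∑ j, MulOpposite.op (f j) • g j) l = _
  rw [Finset.sum_apply]
  rfl

theorem Lphi_apply (h : Fin s → S I) (l : Fin r) :
    Lphi I g h l = ∑ j, sigmaIota I 0 (g j l) * h j := by
  rw [Lphi, Fintype.linearCombination_apply, Finset.sum_apply]
  refine Finset.sum_congr rfl fun j _ => ?_
  rw [Pi.smul_apply, moduleIota_apply, smul_eq_mul, mul_comm]

theorem coord_mem_pieceA (hdeg : ∀ j, g j ∈ piece (pieceA I) (fun _ => 0) (Δ j)) (j : Fin s)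
    (l : Fin r) : g j l ∈ pieceA I (Δ j) := ((mem_piece.1 (hdeg j)) l).1 (Nat.zero_le _)

theorem Lphi_moduleIota (hdeg : ∀ j, g j ∈ piece (pieceA I) (fun _ => 0) (Δ j))
    (f : Fin s → A I) :
    Lphi I g (moduleIota I Δ f) = moduleIota I (fun _ => 0) (phi I g f) := by
  ext l
  rw [Lphi_apply, moduleIota_apply, phi_apply, map_sum]
  refine Finset.sum_congr rfl fun j _ => ?_
  rw [sigmaIota_mul I (coord_mem_pieceA hdeg j l), moduleIota_apply, zero_add]

/-- The element `ι(g_j)` fills exactly the first `Δ_j` places, so it is annihilated by every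
variable there. -/
theorem C_le_ker_Lphi (hdeg : ∀ j, g j ∈ piece (pieceA I) (fun _ => 0) (Δ j)) :
    C I Δ ≤ LinearMap.ker (Lphi I g) := by
  refine Submodule.span_le.2 ?_
  rintro _ ⟨j, k, i, hi, rfl⟩
  rw [SetLike.mem_coe, LinearMap.mem_ker]
  ext l
  rw [Lphi_apply, Pi.zero_apply, Finset.sum_eq_single j]
  · rw [Pi.single_eq_same, mul_comm,
      x_mul_sigmaIota I (coord_mem_pieceA hdeg j l) (Nat.zero_le _) (by omega)]
  · intro j' _ hne
    rw [Pi.single_eq_of_ne hne, mul_zero]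
  · intro h
    exact absurd (Finset.mem_univ j) h

/-- The coefficient vectors `k i` of the factorized coordinates are syzygies of `g`, and recombining
writes the normal form as `∑ b i • ι(k i)`. -/
theorem normalForm_mem_analogue (hI : IsGraded I)
    (hdeg : ∀ j, g j ∈ piece (pieceA I) (fun _ => 0) (Δ j)) {h : Fin s → S I}
    (hh : h ∈ LinearMap.ker (Lphi I g)) :
    normalForm hI Δ h ∈ analogue I Δ (LinearMap.ker (phi I g)) := by
  classical
  let b := Module.Basis.ofVectorSpace 𝕜 (S I)
  choose t ht using fun j => exists_eq_sum_contract_tmul b (factor hI (Δ j) (h j))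
  let u := Finset.univ.biUnion t
  let k := fun i => fun j => contract (b.coord i) (factor hI (Δ j) (h j))
  have hk : ∀ i, k i ∈ LinearMap.ker (phi I g) := by
    intro i
    rw [LinearMap.mem_ker]
    ext l
    have h0 : Lphi I g h l = 0 := by rw [LinearMap.mem_ker.1 hh]; rfl
    rw [Lphi_apply] at h0
    -- Factorizing at place `0` turns `ι(g_j) h_j` into `g_j` acting on the factorization of `h_j`
    -- at `Δ_j`; the `i`-th coordinate functional extracts the relation for `k i`.
    have h1 := congrArg (fun y => contract (b.coord i) (factor hI 0 y)) h0
    simp only [map_zero, map_sum] at h1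
    rw [phi_apply, Pi.zero_apply, ← h1]
    refine Finset.sum_congr rfl fun j _ => ?_
    rw [factor_sigmaIota_mul hI (coord_mem_pieceA hdeg j l), contract_smul, zero_add]
  have hsum : normalForm hI Δ h = ∑ i ∈ u, b i • moduleIota I Δ (k i) := by
    ext j
    rw [normalForm_apply, ht j u (Finset.subset_biUnion_of_mem t (Finset.mem_univ j)), map_sum,
      Finset.sum_apply]
    refine Finset.sum_congr rfl fun i _ => ?_
    rw [Pi.smul_apply, moduleIota_apply, recombine_tmul, smul_eq_mul, mul_comm]
  rw [hsum]
  exact Submodule.sum_mem _ fun i _ =>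
    Submodule.smul_mem _ _ (Submodule.subset_span ⟨k i, hk i, rfl⟩)

/-- The kernel of `L(φ)` is `C + L(Ker φ)`. -/
theorem ker_Lphi (hI : IsGraded I) (hdeg : ∀ j, g j ∈ piece (pieceA I) (fun _ => 0) (Δ j)) :
    LinearMap.ker (Lphi I g) = C I Δ ⊔ analogue I Δ (LinearMap.ker (phi I g)) := by
  apply le_antisymm
  · intro h hh
    rw [← sub_add_cancel h (normalForm hI Δ h)]
    exact Submodule.add_mem_sup (sub_normalForm_mem hI Δ h) (normalForm_mem_analogue hI hdeg hh)
  · refine sup_le (C_le_ker_Lphi hdeg) (Submodule.span_le.2 ?_)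
    rintro _ ⟨f, hf, rfl⟩
    rw [SetLike.mem_coe, LinearMap.mem_ker, Lphi_moduleIota hdeg, LinearMap.mem_ker.1 hf]
    ext l
    rw [moduleIota_apply, Pi.zero_apply, map_zero, Pi.zero_apply]

theorem phi_mem_piece (hdeg : ∀ j, g j ∈ piece (pieceA I) (fun _ => 0) (Δ j)) (d : ℕ)
    (v : Fin s → A I) (hv : v ∈ piece (pieceA I) Δ d) :
    phi I g v ∈ piece (pieceA I) (fun _ => 0) d := by
  rw [mem_piece] at hv ⊢
  refine fun l => ⟨fun _ => ?_, fun h => absurd h (Nat.not_lt_zero d)⟩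
  rw [phi_apply]
  refine Submodule.sum_mem _ fun j _ => ?_
  rcases le_or_gt (Δ j) d with hj | hj
  · have := pieceA_mul_mem I (coord_mem_pieceA hdeg j l) ((hv j).1 hj)
    rwa [Nat.add_sub_cancel' hj] at this
  · rw [(hv j).2 hj, mul_zero]
    exact zero_mem _

theorem Lphi_mem_piece (hdeg : ∀ j, g j ∈ piece (pieceA I) (fun _ => 0) (Δ j)) (d : ℕ)
    (v : Fin s → S I) (hv : v ∈ piece (pieceS I) Δ d) :
    Lphi I g v ∈ piece (pieceS I) (fun _ => 0) d := by
  rw [mem_piece] at hv ⊢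
  refine fun l => ⟨fun _ => ?_, fun h => absurd h (Nat.not_lt_zero d)⟩
  rw [Lphi_apply]
  refine Submodule.sum_mem _ fun j _ => ?_
  rcases le_or_gt (Δ j) d with hj | hj
  · have := pieceS_mul_mem I (sigmaIota_mem_pieceS I (coord_mem_pieceA hdeg j l) 0)
      ((hv j).1 hj)
    rwa [Nat.add_sub_cancel' hj] at this
  · rw [(hv j).2 hj, mul_zero]
    exact zero_mem _

theorem proj_mem_ker_phi {π : ℕ → A I →ₗ[𝕜] A I} (H : IsGradedSpace (pieceA I) π)
    (hdeg : ∀ j, g j ∈ piece (pieceA I) (fun _ => 0) (Δ j)) {v : Fin s → A I}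
    (hv : v ∈ LinearMap.ker (phi I g)) (d : ℕ) :
    (LinearMap.pi fun j => if Δ j ≤ d then π (d - Δ j) ∘ₗ LinearMap.proj j else 0 :
      (Fin s → A I) →ₗ[𝕜] (Fin s → A I)) v ∈ LinearMap.ker (phi I g) := by
  rw [LinearMap.mem_ker] at hv ⊢
  have := (H.pi Δ).map_proj (H.pi fun _ => 0) ((phi I g).restrictScalars 𝕜)
    (phi_mem_piece hdeg) d v
  simp only [LinearMap.coe_restrictScalars, hv, map_zero] at this
  exact this

theorem proj_mem_ker_Lphi {π : ℕ → S I →ₗ[𝕜] S I} (H : IsGradedSpace (pieceS I) π)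
    (hdeg : ∀ j, g j ∈ piece (pieceA I) (fun _ => 0) (Δ j)) {v : Fin s → S I}
    (hv : v ∈ LinearMap.ker (Lphi I g)) (d : ℕ) :
    (LinearMap.pi fun j => if Δ j ≤ d then π (d - Δ j) ∘ₗ LinearMap.proj j else 0 :
      (Fin s → S I) →ₗ[𝕜] (Fin s → S I)) v ∈ LinearMap.ker (Lphi I g) := by
  rw [LinearMap.mem_ker] at hv ⊢
  have := (H.pi Δ).map_proj (H.pi fun _ => 0) ((Lphi I g).restrictScalars 𝕜)
    (Lphi_mem_piece hdeg) d v
  simp only [LinearMap.coe_restrictScalars, hv, map_zero] at this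
  exact this

/-- The coordinates of the syzygies of a minimal basis have positive degree. -/
theorem lt_of_mem_ker_phi (hinj : Function.Injective g) {𝓥 : ℕ → Submodule 𝕜 (Fin r → A I)}
    {M : Submodule (A I)ᵐᵒᵖ (Fin r → A I)} (hmin : IsMinimalBasis 𝓥 M (Set.range g)) {d : ℕ}
    {v : Fin s → A I} (hv : v ∈ piece (pieceA I) Δ d) (hker : v ∈ LinearMap.ker (phi I g))
    {j : Fin s} (hj : v j ≠ 0) : Δ j < d := by
  by_contra hlt
  rcases (not_lt.1 hlt).eq_or_lt with heq | hgt
  -- If `Δ_j = d`, the coordinate is a nonzero scalar, and dividing by it expresses `g j` through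
  -- the others.
  · refine hmin.minimal (g j) ⟨j, rfl⟩ ?_
    have h0 := ((mem_piece.1 hv) j).1 heq.ge
    rw [heq, Nat.sub_self] at h0
    obtain ⟨c, hc⟩ := pieceA_zero I h0
    have hc0 : c ≠ 0 := by
      rintro rfl
      exact hj (hc.trans (map_zero _))
    have hsum : ∑ i, MulOpposite.op (v i) • g i = 0 := LinearMap.mem_ker.1 hker
    rw [← Finset.add_sum_erase _ _ (Finset.mem_univ j)] at hsum
    have hmem : MulOpposite.op (v j) • g j ∈
        Submodule.span (A I)ᵐᵒᵖ (Set.range g \ {g j}) := by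
      rw [eq_neg_of_add_eq_zero_left hsum]
      refine neg_mem (Submodule.sum_mem _ fun i hi => Submodule.smul_mem _ _
        (Submodule.subset_span ⟨⟨i, rfl⟩, fun h => Finset.ne_of_mem_erase hi (hinj h)⟩))
    have := Submodule.smul_mem _ (MulOpposite.op (algebraMap 𝕜 (A I) c⁻¹)) hmem
    rwa [smul_smul, hc, ← MulOpposite.op_mul, ← map_mul, mul_inv_cancel₀ hc0, map_one,
      MulOpposite.op_one, one_smul] at this
  · exact hj (((mem_piece.1 hv) j).2 hgt)

section MinimalBases

variable {M : Submodule (A I)ᵐᵒᵖ (Fin r → A I)} {B : Set (Fin s → A I)} {D : Set (Fin s → S I)}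

/-- Applying the retraction would put `k` in the span of the other elements of `B`. -/
theorem moduleIota_notMem_span (hI : IsGraded I) {N : Submodule (A I)ᵐᵒᵖ (Fin s → A I)}
    (hB : IsMinimalBasis (piece (pieceA I) Δ) N B) {k : Fin s → A I} (hk : k ∈ B) :
    moduleIota I Δ k ∉ C I Δ ⊔ Submodule.span (S I) (moduleIota I Δ '' (B \ {k})) := by
  intro hmem
  -- If `1 ∈ I` then `A` is zero and no normalized functional need exist; but then `k = 0`, against
  -- minimality.
  by_cases h1 : (1 : F 𝕜 n) ∈ I
  · have hA : ∀ a : A I, a = 0 := fun a => by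
      rw [← one_mul a, ← map_one (toA I), toA_eq_zero I h1, zero_mul]
    have : k = 0 := funext fun j => hA (k j)
    exact hB.minimal k hk (this ▸ zero_mem _)
  · obtain ⟨ε, hε⟩ := exists_augmentation I hI h1
    obtain ⟨c, hc, y, hy, hcy⟩ := Submodule.mem_sup.1 hmem
    obtain ⟨d, hd⟩ := hB.homogeneous k hk
    refine hB.minimal k hk ?_
    have := retraction_mem_span hI ε (fun b hb => hB.homogeneous b hb.1) hy
    rwa [← zero_add (retraction hI ε Δ y), ← retraction_eq_zero hI ε hc, ← map_add, hcy,
      retraction_moduleIota hI hε hd] at this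

theorem isMinimalBasis_union (hI : IsGraded I)
    (hdeg : ∀ j, g j ∈ piece (pieceA I) (fun _ => 0) (Δ j)) (hinj : Function.Injective g)
    (hmin : IsMinimalBasis (piece (pieceA I) (fun _ => 0)) M (Set.range g))
    (hB : IsMinimalBasis (piece (pieceA I) Δ) (LinearMap.ker (phi I g)) B)
    (hD : IsMinimalBasis (piece (pieceS I) Δ) (C I Δ) D) :
    IsMinimalBasis (piece (pieceS I) Δ) (LinearMap.ker (Lphi I g))
      (D ∪ moduleIota I Δ '' B) := by
  have hspan := span_image_moduleIota hI Δ hB.homogeneous hB.span_eq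
  refine ⟨?_, ?_, ?_⟩
  · rintro v (hv | ⟨k, hk, rfl⟩)
    · exact hD.homogeneous v hv
    · obtain ⟨d, hd⟩ := hB.homogeneous k hk
      exact ⟨d, moduleIota_mem_piece hd⟩
  · rw [Submodule.span_union, hD.span_eq, hspan, ker_Lphi hI hdeg]
  · rintro v (hv | ⟨k, hk, rfl⟩) hmem
    · obtain ⟨π, hπ⟩ := exists_isGradedSpace_pieceS I hI
      have hle : Submodule.span (S I) ((D ∪ moduleIota I Δ '' B) \ {v}) ≤
          Submodule.span (S I) (D \ {v}) ⊔ Submodule.span (S I) (moduleIota I Δ '' B) := by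
        rw [← Submodule.span_union]
        refine Submodule.span_mono ?_
        rintro w ⟨hw | hw, hne⟩
        exacts [Or.inl ⟨hw, hne⟩, Or.inr hw]
      obtain ⟨z, hz, y, hy, hzy⟩ := Submodule.mem_sup.1 (hle hmem)
      -- Here `y = v - z` lies in both `C` and `L(K)`, hence in `C · S₊`, and Nakayama for `D` gives
      -- the contradiction.
      refine (isGradedAction_pieceS I hπ Δ).minimal_mod_decomposables hD hv hz
        (mem_decomposables_of_mem_span hI (fun b hb => ?_) hy ?_) hzy.symm
      · obtain ⟨d, hd⟩ := hB.homogeneous b hb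
        exact ⟨d, hd, fun j hj => lt_of_mem_ker_phi hinj hmin hd
          (hB.span_eq ▸ Submodule.subset_span hb) hj⟩
      · rw [show y = v - z from eq_sub_of_add_eq' hzy, ← hD.span_eq]
        exact sub_mem (Submodule.subset_span hv)
          (Submodule.span_mono (fun w hw => hw.1) hz)
    · refine moduleIota_notMem_span hI hB hk ?_
      rw [← hD.span_eq, ← Submodule.span_union]
      refine Submodule.span_mono ?_ hmem
      rintro w ⟨hw | ⟨b, hb, rfl⟩, hne⟩
      · exact Or.inl hw
      · exact Or.inr ⟨b, ⟨hb, fun h => hne (by rw [Set.mem_singleton_iff.1 h]; rfl)⟩, rfl⟩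

theorem injOn_moduleIota (hI : IsGraded I) {N : Submodule (A I)ᵐᵒᵖ (Fin s → A I)}
    (hB : IsMinimalBasis (piece (pieceA I) Δ) N B) : Set.InjOn (moduleIota I Δ) B := by
  intro k hk k' hk' h
  by_contra hne
  exact moduleIota_notMem_span hI hB hk (Submodule.mem_sup_right
    (Submodule.subset_span ⟨k', ⟨hk', fun h => hne h.symm⟩, h.symm⟩))

theorem inDegree_image_moduleIota (hI : IsGraded I) {N : Submodule (A I)ᵐᵒᵖ (Fin s → A I)}
    (hB : IsMinimalBasis (piece (pieceA I) Δ) N B) (d : ℕ) :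
    inDegree (piece (pieceS I) Δ) (moduleIota I Δ '' B) d =
      moduleIota I Δ '' inDegree (piece (pieceA I) Δ) B d := by
  ext v
  constructor
  · rintro ⟨⟨k, hk, rfl⟩, hd⟩
    obtain ⟨e, he⟩ := hB.homogeneous k hk
    obtain rfl : e = d := by
      -- A homogeneous element with two degrees is zero, and zero lies in every span.
      by_contra hne
      obtain ⟨π, hπ⟩ := exists_isGradedSpace_pieceS I hI
      refine moduleIota_notMem_span hI hB hk ?_
      rw [(hπ.pi Δ).eq_zero hd (moduleIota_mem_piece he) hne]
      exact zero_mem _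
    exact ⟨k, ⟨hk, he⟩, rfl⟩
  · rintro ⟨k, ⟨hk, hd⟩, rfl⟩
    exact ⟨⟨k, hk, rfl⟩, moduleIota_mem_piece hd⟩

theorem disjoint_image_moduleIota (hI : IsGraded I) {N : Submodule (A I)ᵐᵒᵖ (Fin s → A I)}
    (hB : IsMinimalBasis (piece (pieceA I) Δ) N B)
    (hD : IsMinimalBasis (piece (pieceS I) Δ) (C I Δ) D) :
    Disjoint D (moduleIota I Δ '' B) := by
  rw [Set.disjoint_left]
  rintro _ hv ⟨k, hk, rfl⟩
  exact moduleIota_notMem_span hI hB hk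
    (Submodule.mem_sup_left (hD.span_eq ▸ Submodule.subset_span hv))

end MinimalBases

theorem exists_finite_homogeneous_span_eq_C (Δ : Fin s → ℕ) :
    ∃ X : Set (Fin s → S I), X.Finite ∧ (∀ v ∈ X, ∃ d, v ∈ piece (pieceS I) Δ d) ∧
      Submodule.span (S I) X = C I Δ := by
  refine ⟨_, ?_, ?_, rfl⟩
  · refine (Set.finite_range fun q : Σ j : Fin s, Fin n × Fin (Δ j) =>
      (Pi.single q.1 (x I q.2.1 q.2.2) : Fin s → S I)).subset ?_
    rintro _ ⟨j, k, l, hl, rfl⟩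
    exact ⟨⟨j, k, ⟨l, hl⟩⟩, rfl⟩
  · rintro _ ⟨j, k, l, hl, rfl⟩
    refine ⟨Δ j + 1, mem_piece.2 fun i => ?_⟩
    rcases eq_or_ne i j with rfl | hne
    · rw [Pi.single_eq_same, Nat.add_sub_cancel_left]
      exact ⟨fun _ => x_mem_pieceS I k l, fun h => by omega⟩
    · rw [Pi.single_eq_of_ne hne]
      exact ⟨fun _ => zero_mem _, fun _ => rfl⟩

end Kernels

end Letterplace

/-! ### The theorem: existence of the bases and the count in each degree. -/

open Letterplace in
theorem theorem7p3 {𝕜 : Type*} [Field 𝕜] {n r s : ℕ}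
    (I : Ideal (F 𝕜 n)) [I.IsTwoSided] (hI : IsGraded I)
    (M : Submodule (A I)ᵐᵒᵖ (Fin r → A I))
    (g : Fin s → Fin r → A I) (Δ : Fin s → ℕ)
    (hinj : Function.Injective g)
    (hdeg : ∀ j, g j ∈ piece (pieceA I) (fun _ => 0) (Δ j))
    (hmin : IsMinimalBasis (piece (pieceA I) (fun _ => 0)) M (Set.range g)) :
    LinearMap.ker (Lphi I g) = C I Δ ⊔ analogue I Δ (LinearMap.ker (phi I g)) ∧
    (∃ B, IsMinimalBasis (piece (pieceA I) Δ) (LinearMap.ker (phi I g)) B) ∧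
    (∃ B', IsMinimalBasis (piece (pieceS I) Δ) (LinearMap.ker (Lphi I g)) B') ∧
    (∃ D, IsMinimalBasis (piece (pieceS I) Δ) (C I Δ) D) ∧
    ∀ B B' D,
      IsMinimalBasis (piece (pieceA I) Δ) (LinearMap.ker (phi I g)) B →
      IsMinimalBasis (piece (pieceS I) Δ) (LinearMap.ker (Lphi I g)) B' →
      IsMinimalBasis (piece (pieceS I) Δ) (C I Δ) D →
      ∀ d : ℕ,
        (inDegree (piece (pieceA I) Δ) B d).Finite ∧
        (inDegree (piece (pieceS I) Δ) B' d).Finite ∧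
        (inDegree (piece (pieceS I) Δ) D d).Finite ∧
        ((inDegree (piece (pieceA I) Δ) B d).ncard : ℤ) =
          (inDegree (piece (pieceS I) Δ) B' d).ncard -
            (inDegree (piece (pieceS I) Δ) D d).ncard := by
  obtain ⟨πA, hπA⟩ := exists_isGradedSpace_pieceA I hI
  obtain ⟨πS, hπS⟩ := exists_isGradedSpace_pieceS I hI
  have HA := isGradedAction_pieceA I hπA Δ
  have HS := isGradedAction_pieceS I hπS Δ
  obtain ⟨X, hXfin, hXhom, hXspan⟩ := exists_finite_homogeneous_span_eq_C (I := I) Δ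
  refine ⟨ker_Lphi hI hdeg,
    HA.exists_isMinimalBasis fun v hv d => proj_mem_ker_phi hπA hdeg hv d,
    HS.exists_isMinimalBasis fun v hv d => proj_mem_ker_Lphi hπS hdeg hv d,
    HS.exists_isMinimalBasis fun v hv d => ?_, ?_⟩
  · rw [← hXspan] at hv ⊢
    exact HS.proj_mem_span hXhom hv d
  · intro B B' D hB hB' hD d
    have hBfin := HA.finite_inDegree_of_fg hB (d := d) (piece_fg (pieceA_fg I) Δ d)
    have hDfin := HS.finite_inDegree_of_finite_generators hD hXhom hXspan hXfin d
    have hU := isMinimalBasis_union hI hdeg hinj hmin hB hD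
    have hUdeg : inDegree (piece (pieceS I) Δ) (D ∪ moduleIota I Δ '' B) d =
        inDegree (piece (pieceS I) Δ) D d ∪
          moduleIota I Δ '' inDegree (piece (pieceA I) Δ) B d := by
      rw [← inDegree_image_moduleIota hI hB]
      exact Set.union_inter_distrib_right _ _ _
    have hcard := HS.mk_inDegree_eq hB' hU d
    rw [hUdeg] at hcard
    have hinjB : Set.InjOn (moduleIota I Δ) (inDegree (piece (pieceA I) Δ) B d) :=
      (injOn_moduleIota hI hB).mono fun _ h => h.1
    have hdisj : Disjoint (inDegree (piece (pieceS I) Δ) D d)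
        (moduleIota I Δ '' inDegree (piece (pieceA I) Δ) B d) :=
      (disjoint_image_moduleIota hI hB hD).mono (fun _ h => h.1)
        (Set.image_mono fun _ h => h.1)
    -- Components of `S` can be infinite dimensional, so finiteness for `K'` is read off from the
    -- basis `D ∪ ι(B)`.
    have hfin : (inDegree (piece (pieceS I) Δ) B' d).Finite := by
      rw [← Cardinal.lt_aleph0_iff_set_finite, hcard, Cardinal.lt_aleph0_iff_set_finite]
      exact hDfin.union (hBfin.image _)
    have hncard : (inDegree (piece (pieceS I) Δ) B' d).ncard =
        (inDegree (piece (pieceS I) Δ) D d).ncard +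
          (inDegree (piece (pieceA I) Δ) B d).ncard := by
      rw [← hinjB.ncard_image, ← Set.ncard_union_eq hdisj hDfin (hBfin.image _)]
      exact congrArg Cardinal.toNat hcard
    exact ⟨hBfin, hfin, hDfin, by rw [hncard]; push_cast; ring⟩
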